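/- Quantum systems $A',B',A,B,R$ are described by nonzero separable complex Hilbert spaces of finite or infinite dimension $|A'|,|B'|,\dots\in\{1,2,\dots,\infty\}$; $\log$ is to base $2$, and $\log\infty=+\infty$. Let $\mathrm{St}(X)$ be the set of density operators of a system $X$, and $\mathrm{Q}(X',X)$ the set of quantum channels from $X'$ to $X$, i.e. of completely positive trace-preserving linear maps between the spaces of trace-class operators. Let $\mathcal R_{A'\to A}(X)=\operatorname{tr}(X)\,\mathbb 1_A$ be the completely mixing map, and let $D(\rho\Vert\sigma)=\lim_{\varepsilon\to0^+}\operatorname{tr}\big(\rho\,(\log(\rho+\varepsilon\mathbb 1)-\log(\sigma+\varepsilon\mathbb 1))\big)\in[-\infty,+\infty]$ be the Umegaki relative entropy of a state $\rho$ and a positive bounded operator $\sigma$ (read as the upper limit in the degenerate infinite-dimensional cases in which the limit need not exist); in finite dimension, $D(\rho\Vert\sigma)=\operatorname{tr}(\rho(\log\rho-\log\sigma))$ if $\operatorname{supp}\rho\subseteq\operatorname{supp}\sigma$, and $D(\rho\Vert\sigma)=+\infty$ otherwise. For a channel $\mathcal N$ and a completely positive map $\mathcal M$ with the same input system $X'$,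 put $$D[\mathcal N\Vert\mathcal M]=\sup_{R,\ \rho\in\mathrm{St}(RX')}D\big((\mathrm{id}_R\otimes\mathcal N)(\rho)\,\big\Vert\,(\mathrm{id}_R\otimes\mathcal M)(\rho)\big).$$ The von Neumann conditional entropy of a bipartite channel $\mathcal N\in\mathrm{Q}(A'B',AB)$ is $$S[A|B]_{\mathcal N}=-\inf_{\mathcal M\in\mathrm{Q}(B',B)}D[\mathcal N_{A'B'\to AB}\Vert\mathcal R_{A'\to A}\otimes\mathcal M_{B'\to B}].$$ The channel $\mathcal N$ is called semicausal from $A'$ to $B$ if there is a channel $\widetilde{\mathcal N}\in\mathrm{Q}(B',B)$ with $\operatorname{tr}_A\circ\,\mathcal N_{A'B'\to AB}=\operatorname{tr}_{A'}\otimes\widetilde{\mathcal N}_{B'\to B}$; otherwise it is said to be signaling, or to have causal influence, from $A'$ to $B$. It is called unitary if $\mathcal N(X)=UXU^\dagger$ for a unitary operator $U$ from the Hilbert space of $A'B'$ onto that of $AB$. Let $\mathcal N\in\mathrm{Q}(A'B',AB)$. 1. If $\mathcal N$ is semicausal from $A'$ to $B$, then $S[A|B]_{\mathcal N}\ge-\log|A|$.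 2. If $\mathcal N$ is semicausal from $A'$ to $B$ and unitary, then $S[A|B]_{\mathcal N}=-\log|A|$. 3. If $S[A|B]_{\mathcal N}<-\log|A|$, then $\mathcal N$ has causal influence (is signaling) from $A'$ to $B$. -/

import Mathlib

open scoped ComplexOrder Kronecker Topology InnerProductSpace lp

noncomputable section

namespace QChannel

/-! A quantum system with separable Hilbert space, of finite or countably infinite dimension, is
given by a countable type `ι` that labels an orthonormal basis: its Hilbert space is `ℓ²(ι, ℂ)`,
its dimension is the number of elements of `ι`, and the composite of `ι` and `κ` is `ι × κ`.
Operators are written as (possibly infinite) matrices in these bases. -/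

/-- Trace-class operators on `ℓ²(ι, ℂ)`: the linear span of the positive semidefinite matrices with
summable diagonal (these are exactly the matrices of the positive operators of finite trace). -/
def TraceClass (ι : Type*) : Submodule ℂ (Matrix ι ι ℂ) :=
  Submodule.span ℂ {X | X.PosSemidef ∧ Summable fun i => X i i}

/-- The trace of a trace-class operator. -/
def tr {ι : Type*} (X : TraceClass ι) : ℂ := ∑' i, X.1 i i

/-- Density operators: positive trace-class operators of unit trace. -/
def IsState {ι : Type*} (ρ : TraceClass ι) : Prop := ρ.1.PosSemidef ∧ tr ρ = 1

/-! ### Blocks and partial traces of trace-class operators -/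

theorem norm_entry_le {ι : Type*} {X : Matrix ι ι ℂ} (hX : X.PosSemidef) (i j : ι) :
    ‖X i j‖ ≤ ‖X i i‖ + ‖X j j‖ := by
  have key : ∀ c : ℂ, 0 ≤ X i i + c * X i j + star c * X j i + star c * c * X j j := by
    intro c
    have h := (hX.submatrix ![i, j]).dotProduct_mulVec_nonneg ![1, c]
    simp only [dotProduct, Matrix.mulVec, Fin.sum_univ_two, Matrix.submatrix_apply, Pi.star_apply,
      Matrix.cons_val_zero, Matrix.cons_val_one, star_one] at h
    convert h using 1
    ring
  have hji : X j i = star (X i j) := (hX.1.apply j i).symm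
  obtain ⟨c, hc1, hc2⟩ : ∃ c : ℂ, star c * c = 1 ∧ c * X i j = -(‖X i j‖ : ℂ) := by
    by_cases h0 : X i j = 0
    · exact ⟨1, by simp, by simp [h0]⟩
    · have hn : (‖X i j‖ : ℂ) ≠ 0 := by simpa using h0
      have hm : star (X i j) * X i j = (‖X i j‖ : ℂ) ^ 2 := by
        simpa using Complex.conj_mul' (X i j)
      refine ⟨-(star (X i j) / (‖X i j‖ : ℂ)), ?_, ?_⟩
      · have : star (-(star (X i j) / (‖X i j‖ : ℂ))) = -(X i j / (‖X i j‖ : ℂ)) := by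
          simp
        rw [this]
        field_simp
        linear_combination hm
      · field_simp
        linear_combination -hm
  have h := key c
  have h2 : star c * X j i = -(‖X i j‖ : ℂ) := by
    rw [hji, ← star_mul', hc2]; simp
  rw [hc2, h2, hc1, one_mul] at h
  have hre := (Complex.le_def.1 h).1
  simp only [Complex.zero_re, Complex.add_re, Complex.neg_re, Complex.ofReal_re] at hre
  have a1 := Complex.re_le_norm (X i i)
  have a2 := Complex.re_le_norm (X j j)
  have a3 := norm_nonneg (X i j)
  linarith

/-- The block `⟨r| X |s⟩`, an operator on `ι`, of an operator `X` on `R × ι`. -/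
def blockMatrix {R ι : Type*} (r s : R) : Matrix (R × ι) (R × ι) ℂ →ₗ[ℂ] Matrix ι ι ℂ where
  toFun X := X.submatrix (Prod.mk r) (Prod.mk s)
  map_add' _ _ := rfl
  map_smul' _ _ := rfl

theorem blockMatrix_apply {R ι : Type*} (r s : R) (X : Matrix (R × ι) (R × ι) ℂ) (i j : ι) :
    blockMatrix r s X i j = X (r, i) (s, j) := rfl

theorem blockMatrix_comb_mem {R ι : Type*} (r s : R) {X : Matrix (R × ι) (R × ι) ℂ}
    (hX : X.PosSemidef) (hs : Summable fun i => X i i) (c : ℂ) :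
    blockMatrix r r X + c • blockMatrix r s X + star c • blockMatrix s r X
      + (star c * c) • blockMatrix s s X ∈ TraceClass ι := by
  classical
  have hsr : ∀ t : R, Summable fun i : ι => ‖X (t, i) (t, i)‖ := fun t =>
    hs.norm.comp_injective (Prod.mk_right_injective t)
  have hoff : ∀ t u : R, Summable fun i : ι => X (t, i) (u, i) := fun t u =>
    Summable.of_norm_bounded ((hsr t).add (hsr u)) fun i => norm_entry_le hX _ _
  refine Submodule.subset_span ⟨⟨?_, fun x => ?_⟩, ?_⟩
  · ext i j
    have h1 := hX.1.apply (r, i) (r, j)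
    have h2 := hX.1.apply (r, i) (s, j)
    have h3 := hX.1.apply (s, i) (r, j)
    have h4 := hX.1.apply (s, i) (s, j)
    simp only [blockMatrix_apply, Matrix.conjTranspose_apply, Matrix.add_apply, Matrix.smul_apply,
      smul_eq_mul, star_add, star_mul', star_star, h1, h2, h3, h4]
    ring
  · have h := hX.2 (x.mapDomain (Prod.mk r) + (x.mapDomain (Prod.mk s)).mapRange (c * ·) (by simp))
    convert h using 1
    have e : ∀ (F : R × ι → ℂ → ℂ), (∀ p, F p 0 = 0) → (∀ p a b, F p (a + b) = F p a + F p b) →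
        (x.mapDomain (Prod.mk r) + (x.mapDomain (Prod.mk s)).mapRange (c * ·) (by simp)).sum F
          = x.sum fun i a => F (r, i) a + F (s, i) (c * a) := by
      intro F h0 hadd
      rw [Finsupp.sum_add_index' h0 hadd, Finsupp.sum_mapRange_index h0,
        Finsupp.sum_mapDomain_index h0 hadd, Finsupp.sum_mapDomain_index
          (by simp [h0]) (by simp [mul_add, hadd]), Finsupp.sum_add]
    rw [e _ (by simp) (by intros; simp [add_mul, Finsupp.sum_add])]
    refine Finsupp.sum_congr fun i _ => ?_
    rw [e _ (by simp) (by intros; ring), e _ (by simp) (by intros; ring), ← Finsupp.sum_add]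
    refine Finsupp.sum_congr fun j _ => ?_
    simp only [blockMatrix_apply, Matrix.add_apply, Matrix.smul_apply, smul_eq_mul, star_mul']
    ring
  · exact (((hoff r r).add ((hoff r s).mul_left c)).add ((hoff s r).mul_left (star c))).add
      ((hoff s s).mul_left (star c * c))

theorem blockMatrix_mem {R ι : Type*} (r s : R) {X : Matrix (R × ι) (R × ι) ℂ}
    (hX : X ∈ TraceClass (R × ι)) : blockMatrix r s X ∈ TraceClass ι := by
  suffices h : TraceClass (R × ι) ≤ (TraceClass ι).comap (blockMatrix r s) from h hX
  refine Submodule.span_le.2 ?_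
  rintro X ⟨hX, hs⟩
  have hc := blockMatrix_comb_mem r s hX hs
  have h4 : blockMatrix r s X = (1 / 4 : ℂ) •
      ((blockMatrix r r X + (1 : ℂ) • blockMatrix r s X + star (1 : ℂ) • blockMatrix s r X
          + (star (1 : ℂ) * 1) • blockMatrix s s X)
        - (blockMatrix r r X + (-1 : ℂ) • blockMatrix r s X + star (-1 : ℂ) • blockMatrix s r X
          + (star (-1 : ℂ) * (-1)) • blockMatrix s s X)
        - Complex.I • (blockMatrix r r X + Complex.I • blockMatrix r s X
          + star Complex.I • blockMatrix s r X + (star Complex.I * Complex.I) • blockMatrix s s X)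
        + Complex.I • (blockMatrix r r X + (-Complex.I) • blockMatrix r s X
          + star (-Complex.I) • blockMatrix s r X
          + (star (-Complex.I) * (-Complex.I)) • blockMatrix s s X)) := by
    ext i j
    simp only [Matrix.add_apply, Matrix.sub_apply, Matrix.smul_apply, smul_eq_mul, star_one,
      star_neg, Complex.star_def, Complex.conj_I]
    linear_combination (1 / 2 : ℂ) * (blockMatrix r s X i j - blockMatrix s r X i j) * Complex.I_sq
  change blockMatrix r s X ∈ TraceClass ι
  rw [h4]
  exact Submodule.smul_mem _ _ (Submodule.add_mem _ (Submodule.sub_mem _ (Submodule.sub_mem _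
    (hc 1) (hc (-1))) (Submodule.smul_mem _ _ (hc _))) (Submodule.smul_mem _ _ (hc _)))

/-- The block `⟨r| X |s⟩` of a trace-class operator `X` on `R × ι`. -/
def block {R ι : Type*} (r s : R) (X : TraceClass (R × ι)) : TraceClass ι :=
  ⟨blockMatrix r s X.1, blockMatrix_mem r s X.2⟩

theorem summable_fiber {ι κ : Type*} {X : Matrix (ι × κ) (ι × κ) ℂ} (hX : X ∈ TraceClass (ι × κ))
    (k l : κ) : Summable fun i => X (i, k) (i, l) := by
  unfold TraceClass at hX
  induction hX using Submodule.span_induction with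
  | mem X h =>
    have hn : ∀ t : κ, Summable fun i : ι => ‖X (i, t) (i, t)‖ := fun t =>
      h.2.norm.comp_injective (Prod.mk_left_injective t)
    exact Summable.of_norm_bounded ((hn k).add (hn l)) fun i => norm_entry_le h.1 _ _
  | zero => simp
  | add X Y _ _ hX hY => exact hX.add hY
  | smul c X _ hX => exact hX.mul_left c

theorem partialTrace_mem {ι κ : Type*} {X : Matrix (ι × κ) (ι × κ) ℂ}
    (hX : X ∈ TraceClass (ι × κ)) :
    (Matrix.of fun k l => ∑' i, X (i, k) (i, l)) ∈ TraceClass κ := by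
  have hX' := hX
  unfold TraceClass at hX'
  induction hX' using Submodule.span_induction with
  | mem X h =>
    have hf := summable_fiber hX
    refine Submodule.subset_span ⟨⟨?_, fun x => ?_⟩, ?_⟩
    · ext k l
      simp only [Matrix.conjTranspose_apply, Matrix.of_apply, tsum_star]
      exact tsum_congr fun i => h.1.1.apply _ _
    · have e : (x.sum fun k a => x.sum fun l b =>
            star a * (Matrix.of fun k l => ∑' i, X (i, k) (i, l)) k l * b)
          = ∑' i, x.sum fun k a => x.sum fun l b => star a * X (i, k) (i, l) * b := by
        simp only [Finsupp.sum, Matrix.of_apply]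
        rw [Summable.tsum_finsetSum fun k _ => summable_sum fun l _ =>
          ((hf k l).mul_left _).mul_right _]
        refine Finset.sum_congr rfl fun k _ => ?_
        rw [Summable.tsum_finsetSum fun l _ => ((hf k l).mul_left _).mul_right _]
        refine Finset.sum_congr rfl fun l _ => ?_
        rw [tsum_mul_right, tsum_mul_left]
      rw [e]
      exact tsum_nonneg fun i => (h.1.submatrix (Prod.mk i)).2 x
    · exact h.2.prod_symm.prod
  | zero =>
    convert (TraceClass κ).zero_mem
    ext k l
    simp
  | add X Y hX1 hY1 hX2 hY2 =>
    convert (TraceClass κ).add_mem (hX2 hX1) (hY2 hY1) using 1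
    ext k l
    exact (summable_fiber hX1 k l).tsum_add (summable_fiber hY1 k l)
  | smul c X hX1 hX2 =>
    convert (TraceClass κ).smul_mem c (hX2 hX1) using 1
    ext k l
    exact tsum_mul_left

/-- The partial trace over the first factor. -/
def partialTrace (ι κ : Type*) : TraceClass (ι × κ) →ₗ[ℂ] TraceClass κ where
  toFun X := ⟨Matrix.of fun k l => ∑' i, X.1 (i, k) (i, l), partialTrace_mem X.2⟩
  map_add' X Y := by
    ext k l
    exact (summable_fiber X.2 k l).tsum_add (summable_fiber Y.2 k l)
  map_smul' c X := by
    ext k l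
    exact tsum_mul_left

/-! ### Channels -/

/-- `id_R ⊗ Φ`, evaluated at `X`: the map `Φ` is applied to every block of `X`. The values of `Φ`
need not be of trace class. -/
def amplify {R ι κ : Type*} (Φ : TraceClass ι →ₗ[ℂ] Matrix κ κ ℂ) (X : TraceClass (R × ι)) :
    Matrix (R × κ) (R × κ) ℂ :=
  Matrix.of fun p q => Φ (block p.1 q.1 X) p.2 q.2

/-- Complete positivity: all the maps `id ⊗ Φ` with a finite-dimensional ancilla are positive. -/
def IsCompletelyPositive {ι κ : Type*} (Φ : TraceClass ι →ₗ[ℂ] Matrix κ κ ℂ) : Prop :=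
  ∀ (n : ℕ) (X : TraceClass (Fin n × ι)), X.1.PosSemidef → (amplify Φ X).PosSemidef

/-- Quantum channels: completely positive trace-preserving linear maps. -/
structure Channel (ι κ : Type*) where
  map : TraceClass ι →ₗ[ℂ] TraceClass κ
  completelyPositive : IsCompletelyPositive ((TraceClass κ).subtype ∘ₗ map)
  trace_preserving : ∀ X, tr (map X) = tr X

/-- A channel as a map into the space of all operators. -/
def Channel.toOperators {ι κ : Type*} (N : Channel ι κ) : TraceClass ι →ₗ[ℂ] Matrix κ κ ℂ :=
  (TraceClass κ).subtype ∘ₗ N.map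

open Classical in
/-- `R_{A'→A} ⊗ M`, where `R_{A'→A}(X) = tr(X) 1_A` is the completely mixing map and `M` is a
channel from `B'` to `B`: the map `X ↦ 1_A ⊗ M(tr_{A'} X)`. -/
def mixingTensor {A' B' B : Type*} (A : Type*) (M : Channel B' B) :
    TraceClass (A' × B') →ₗ[ℂ] Matrix (A × B) (A × B) ℂ where
  toFun X := (1 : Matrix A A ℂ) ⊗ₖ (M.map (partialTrace A' B' X)).1
  map_add' X Y := by simp [Matrix.kronecker_add]
  map_smul' c X := by simp [Matrix.kronecker_smul]

/-- `N` is semicausal (no-signaling) from `A'` to `B`: `tr_A ∘ N = tr_{A'} ⊗ Ñ` for some channel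
`Ñ` from `B'` to `B`. -/
def IsSemicausal {A' B' A B : Type*} (N : Channel (A' × B') (A × B)) : Prop :=
  ∃ Nred : Channel B' B, ∀ X : TraceClass (A' × B'),
    partialTrace A B (N.map X) = Nred.map (partialTrace A' B' X)

/-- `N` is signaling from `A'` to `B`, i.e. has causal influence from `A'` to `B`. -/
def IsSignaling {A' B' A B : Type*} (N : Channel (A' × B') (A × B)) : Prop := ¬ IsSemicausal N

/-! ### Operators on `ℓ²` and relative entropy -/

open Classical in
/-- The bounded operator on `ℓ²(ι, ℂ)` with the given matrix; it exists for the matrices of trace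
class and for the values of `mixingTensor` and of its amplifications. -/
def toOp {ι : Type*} (X : Matrix ι ι ℂ) : ℓ²(ι, ℂ) →L[ℂ] ℓ²(ι, ℂ) :=
  if h : ∃ T : ℓ²(ι, ℂ) →L[ℂ] ℓ²(ι, ℂ), ∀ i j, T (lp.single 2 j (1 : ℂ)) i = X i j then
    h.choose
  else 0

/-- `N` is a unitary channel: `N(X) = U X U†` for a unitary operator `U`. -/
def IsUnitaryChannel {ι κ : Type*} (N : Channel ι κ) : Prop :=
  ∃ U : ℓ²(ι, ℂ) ≃ₗᵢ[ℂ] ℓ²(κ, ℂ), ∀ (X : TraceClass ι) (v : ℓ²(κ, ℂ)),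
    toOp (N.map X).1 v = U (toOp X.1 (U.symm v))

open Classical in
/-- The real number `tr(ρ (log(ρ + ε 1) - log(σ + ε 1)))`, with logarithms to base 2 defined by the
continuous functional calculus. -/
def regRelEntropy {ι : Type*} (ρ σ : Matrix ι ι ℂ) (ε : ℝ) : ℝ :=
  (∑' i, (toOp ρ ((CFC.log (toOp ρ + ε • 1) - CFC.log (toOp σ + ε • 1)) (lp.single 2 i (1 : ℂ))) i
    ).re) / Real.log 2

/-- The Umegaki relative entropy `D(ρ‖σ)` (base 2) of a state `ρ` and a positive bounded operator
`σ`, as the limit of `tr(ρ (log(ρ + ε 1) - log(σ + ε 1)))` for `ε → 0+`.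
In finite dimension this limit is `tr(ρ (log ρ - log σ))` if the support of `ρ` lies in that of `σ`,
and `+∞` otherwise. In infinite dimension, for spectral decompositions `ρ = ∑ pᵢ |φᵢ⟩⟨φᵢ|` and
`σ = ∑ qⱼ |χⱼ⟩⟨χⱼ|`, it is `∑ pᵢ |⟨φᵢ|χⱼ⟩|² (log pᵢ - log qⱼ)` whenever the positive or the negative
part of this sum is finite (by monotone convergence of both parts); this avoids the difference
of `tr(ρ log ρ)` and `tr(ρ log σ)`, both of which may be infinite. -/
def relEntropy {ι : Type*} (ρ σ : Matrix ι ι ℂ) : EReal :=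
  Filter.limsup (fun ε : ℝ => (regRelEntropy ρ σ ε : EReal)) (𝓝[>] 0)

/-- The channel relative entropy `D[Φ‖Ψ]`: the supremum of `D((id_R ⊗ Φ)(ρ)‖(id_R ⊗ Ψ)(ρ))` over all
reference systems `R` with separable Hilbert space and all states `ρ` of `R × ι`. -/
def channelRelEntropy {ι κ : Type*} (Φ Ψ : TraceClass ι →ₗ[ℂ] Matrix κ κ ℂ) : EReal :=
  ⨆ (R : Type) (_ : Countable R) (ρ : TraceClass (R × ι)) (_ : IsState ρ),
    relEntropy (amplify Φ ρ) (amplify Ψ ρ)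

/-- The von Neumann conditional entropy
`S[A|B]_N = - inf_{M ∈ Q(B',B)} D[N ‖ R_{A'→A} ⊗ M]` of a bipartite channel. -/
def condEntropy {A' B' A B : Type*} (N : Channel (A' × B') (A × B)) : EReal :=
  -⨅ M : Channel B' B, channelRelEntropy N.toOperators (mixingTensor A M)

open Classical in
/-- `log |A|` (base 2), with value `+∞` if `|A| = ∞`. -/
def logDim (A : Type*) : EReal :=
  if Finite A then ((Real.logb 2 (Nat.card A) : ℝ) : EReal) else ⊤

end QChannel

end

open QChannel

open scoped ComplexOrder Kronecker Topology InnerProductSpace lp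

noncomputable section

namespace QChannel

/-! ### Matrices of bounded operators on `ℓ²` -/

/-! Lower bound. Let `N` be semicausal with reduced channel `Nred`, and take `M = Nred`. For a state
`ρ` with output `ω = (id ⊗ N)(ρ)`, semicausality turns the second argument of the relative entropy
into `1_A ⊗ tr_A ω`. If `A` is finite, then `ω ≤ |A| (1_A ⊗ tr_A ω)`
(`posSemidef_card_smul_idTensor_sub`), and operator monotonicity of the logarithm gives `D ≤ log
|A|` (`relEntropy_le_logb`). If `A` is infinite, the bound `-∞` is trivial. The third claim is the
contrapositive.

Upper bound. Let `N` be conjugation by a unitary `U`, and let `M` be any channel. Pull a maximally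
entangled vector of a reference of dimension `n` with `n` basis states of `A`, times a fixed basis
state of `B`, back through `U`. The output is then this pure state `φ`, while the second argument is
`1_A ⊗ τ` with `tr τ = 1`, so `⟨φ, (1_A ⊗ τ) φ⟩ ≤ 1/n`. Concavity of the logarithm gives `D(φ‖σ) ≥
-log ⟨φ, σ φ⟩` (`logb_inv_le_relEntropy`), hence `D ≥ log n`. Take `n = |A|`, or `n` arbitrarily
large.

In infinite dimension one also has to show that the matrices involved define bounded operators
(`exists_hasMatrix`), that positivity passes between matrices and operators, and that traces of
products converge (`exists_hasSum_trace_mul`). -/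

open Classical in
/-- The basis vector of `ℓ²(ι, ℂ)` labelled by `i`. -/
def ket {ι : Type*} (i : ι) : ℓ²(ι, ℂ) := lp.single 2 i (1 : ℂ)

theorem ket_apply_self {ι : Type*} (i : ι) : ket i i = 1 := by
  simp [ket]

theorem ket_apply_ne {ι : Type*} {i j : ι} (h : j ≠ i) : ket i j = 0 := by
  simp [ket, h]

theorem inner_ket_left {ι : Type*} (i : ι) (v : ℓ²(ι, ℂ)) : ⟪ket i, v⟫_ℂ = v i := by
  simp [ket, lp.inner_single_left]

theorem inner_ket_right {ι : Type*} (i : ι) (v : ℓ²(ι, ℂ)) : ⟪v, ket i⟫_ℂ = star (v i) := by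
  rw [← inner_conj_symm, inner_ket_left]; rfl

theorem norm_ket {ι : Type*} (i : ι) : ‖ket i‖ = 1 := by
  simp [ket, lp.norm_single]

theorem hasSum_ket {ι : Type*} (v : ℓ²(ι, ℂ)) : HasSum (fun i => v i • ket i) v := by
  classical
  convert lp.hasSum_single (p := 2) (by simp) v using 2 with i
  rw [ket, ← lp.single_smul]
  simp

/-- Finitely supported vectors in `ℓ²(ι, ℂ)`. -/
def finVec (ι : Type*) : (ι →₀ ℂ) →ₗ[ℂ] ℓ²(ι, ℂ) := Finsupp.linearCombination ℂ ket

theorem finVec_apply {ι : Type*} (x : ι →₀ ℂ) : finVec ι x = x.sum fun i a => a • ket i := rfl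

theorem finVec_single {ι : Type*} (i : ι) : finVec ι (.single i 1) = ket i := by
  simp [finVec]

theorem denseRange_finVec (ι : Type*) : DenseRange (finVec ι) := by
  intro v
  refine mem_closure_of_tendsto (hasSum_ket v) (Filter.Eventually.of_forall fun s => ?_)
  refine ⟨∑ i ∈ s, .single i (v i), ?_⟩
  simp [finVec]

theorem inner_finVec_left {ι : Type*} (y : ι →₀ ℂ) (v : ℓ²(ι, ℂ)) :
    ⟪finVec ι y, v⟫_ℂ = y.sum fun i a => star a * v i := by
  rw [finVec_apply, Finsupp.sum_inner]
  refine Finsupp.sum_congr fun i _ => ?_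
  exact (inner_smul_left _ _ _).trans (congrArg _ (inner_ket_left i v))

/-- The operator `T` has the matrix `W` in the standard basis. -/
def HasMatrix {ι : Type*} (T : ℓ²(ι, ℂ) →L[ℂ] ℓ²(ι, ℂ)) (W : Matrix ι ι ℂ) : Prop :=
  ∀ i j, T (ket j) i = W i j

theorem HasMatrix.add {ι : Type*} {S T : ℓ²(ι, ℂ) →L[ℂ] ℓ²(ι, ℂ)} {V W : Matrix ι ι ℂ}
    (hS : HasMatrix S V) (hT : HasMatrix T W) : HasMatrix (S + T) (V + W) := fun i j => by
  simp [hS i j, hT i j]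

theorem HasMatrix.sub {ι : Type*} {S T : ℓ²(ι, ℂ) →L[ℂ] ℓ²(ι, ℂ)} {V W : Matrix ι ι ℂ}
    (hS : HasMatrix S V) (hT : HasMatrix T W) : HasMatrix (S - T) (V - W) := fun i j => by
  simp [hS i j, hT i j]

theorem HasMatrix.smul {ι : Type*} {T : ℓ²(ι, ℂ) →L[ℂ] ℓ²(ι, ℂ)} {W : Matrix ι ι ℂ} (c : ℂ)
    (hT : HasMatrix T W) : HasMatrix (c • T) (c • W) := fun i j => by
  simp [hT i j]

theorem HasMatrix.inner_finVec {ι : Type*} {T : ℓ²(ι, ℂ) →L[ℂ] ℓ²(ι, ℂ)} {W : Matrix ι ι ℂ}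
    (hT : HasMatrix T W) (x y : ι →₀ ℂ) :
    ⟪finVec ι y, T (finVec ι x)⟫_ℂ
      = y.sum fun i a => x.sum fun j b => star a * W i j * b := by
  rw [inner_finVec_left]
  refine Finsupp.sum_congr fun i _ => ?_
  rw [finVec_apply, map_finsuppSum, Finsupp.sum, lp.coeFn_sum, Finset.sum_apply, Finset.mul_sum]
  refine Finset.sum_congr rfl fun j _ => ?_
  rw [map_smul, lp.coeFn_smul, Pi.smul_apply, hT i j, smul_eq_mul]
  ring

theorem HasMatrix.unique {ι : Type*} {S T : ℓ²(ι, ℂ) →L[ℂ] ℓ²(ι, ℂ)} {W : Matrix ι ι ℂ}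
    (hS : HasMatrix S W) (hT : HasMatrix T W) : S = T := by
  have h : ∀ j, S (ket j) = T (ket j) := fun j => lp.ext <| funext fun i => by rw [hS, hT]
  ext1 v
  have h1 := (hasSum_ket v).mapL S
  have h2 := (hasSum_ket v).mapL T
  simp only [map_smul, h] at h1 h2
  exact h1.unique h2

theorem hasMatrix_toOp {ι : Type*} {W : Matrix ι ι ℂ} (h : ∃ T, HasMatrix T W) :
    HasMatrix (toOp W) W := by
  -- The decidability instance is spelled out to match the condition on which `toOp` branches.
  have h' : ∃ T : ℓ²(ι, ℂ) →L[ℂ] ℓ²(ι, ℂ), ∀ i j,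
    T (@lp.single ι (fun _ => ℂ) _ (fun a b => Classical.propDecidable (a = b)) 2 j (1 : ℂ)) i
      = W i j := h
  intro i j
  rw [toOp, dif_pos h']
  exact h'.choose_spec i j

theorem HasMatrix.toOp_eq {ι : Type*} {T : ℓ²(ι, ℂ) →L[ℂ] ℓ²(ι, ℂ)} {W : Matrix ι ι ℂ}
    (hT : HasMatrix T W) : toOp W = T :=
  (hasMatrix_toOp ⟨T, hT⟩).unique hT

/-- Positivity of a matrix is tested on finitely supported vectors; these are dense, and the
condition is closed. -/
theorem HasMatrix.nonneg {ι : Type*} {T : ℓ²(ι, ℂ) →L[ℂ] ℓ²(ι, ℂ)} {W : Matrix ι ι ℂ}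
    (hT : HasMatrix T W) (hW : W.PosSemidef) : 0 ≤ T := by
  have h : ∀ v, 0 ≤ ⟪v, T v⟫_ℂ := by
    intro v
    refine (denseRange_finVec ι).induction_on
      (p := fun v => 0 ≤ ⟪v, T v⟫_ℂ) v ?_ fun x => ?_
    · exact isClosed_le continuous_const (by fun_prop)
    · rw [hT.inner_finVec]
      exact hW.2 x
  rw [ContinuousLinearMap.nonneg_iff_isPositive, ContinuousLinearMap.isPositive_iff_complex]
  intro v
  have hv : 0 ≤ ⟪T v, v⟫_ℂ := by
    rw [← inner_conj_symm]
    exact star_nonneg_iff.2 (h v)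
  rw [Complex.le_def] at hv
  refine ⟨Complex.ext (by simp) (by simpa using hv.2), by simpa using hv.1⟩

/-- A positive semidefinite matrix `W ≤ C` is the matrix of a bounded operator. -/
theorem exists_hasMatrix {ι : Type*} [DecidableEq ι] {W : Matrix ι ι ℂ} (hW : W.PosSemidef) {C : ℝ}
    (hC : ((C : ℂ) • (1 : Matrix ι ι ℂ) - W).PosSemidef) : ∃ T, HasMatrix T W := by
  wlog hC0 : 0 < C generalizing C
  -- A nonpositive `C` may be enlarged to `1`.
  · refine this (C := C + (1 - C)) ?_ (by simp)
    have : ((C + (1 - C) : ℝ) : ℂ) • (1 : Matrix ι ι ℂ) - W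
        = ((C : ℂ) • (1 : Matrix ι ι ℂ) - W) + ((1 - C : ℝ) : ℂ) • (1 : Matrix ι ι ℂ) := by
      push_cast
      rw [add_smul]; abel
    rw [this]
    exact hC.add (Matrix.PosSemidef.one.smul (by
      rw [Complex.zero_le_real]; linarith [not_lt.1 hC0]))
  -- The sesquilinear form of `W`. The hypotheses say `0 ≤ B x x ≤ C ‖x‖²`; the operator is built
  -- from its columns on finitely supported vectors and extended by density.
  let B : (ι →₀ ℂ) → (ι →₀ ℂ) → ℂ :=
    fun y x => y.sum fun i a => x.sum fun j b => star a * W i j * b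
  have hBsub : ∀ x y, B (x - y) (x - y) = B x x - B x y - B y x + B y y := by
    intro x y
    have h1 : ∀ y z w, B y (z - w) = B y z - B y w := by
      intro y z w
      simp only [B, ← Finsupp.sum_sub]
      refine Finsupp.sum_congr fun i _ => ?_
      rw [Finsupp.sum_sub_index]
      intros; ring
    have h2 : ∀ y z w, B (z - w) y = B z y - B w y := by
      intro y z w
      simp only [B]
      rw [Finsupp.sum_sub_index]
      intro i a b
      rw [← Finsupp.sum_sub]
      refine Finsupp.sum_congr fun i _ => ?_
      rw [star_sub]; ring
    rw [h1, h2, h2]; ring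
  have hBsymm : ∀ x y, B x y = star (B y x) := by
    intro x y
    simp only [B, Finsupp.sum, star_sum]
    rw [Finset.sum_comm]
    refine Finset.sum_congr rfl fun i _ => Finset.sum_congr rfl fun j _ => ?_
    rw [star_mul', star_mul', star_star, hW.1.apply]
    ring
  have hnorm : ∀ x, (B x x).re ≤ C * ‖finVec ι x‖ ^ 2 := by
    intro x
    have h1 : HasMatrix ((C : ℂ) • (1 : ℓ²(ι, ℂ) →L[ℂ] ℓ²(ι, ℂ))) ((C : ℂ) • (1 : Matrix ι ι ℂ)) := by
      refine HasMatrix.smul _ fun i j => ?_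
      rcases eq_or_ne i j with rfl | h
      · simp [ket_apply_self]
      · simp [h, ket_apply_ne h]
    have h2 := h1.inner_finVec x x
    have h3 := hC.2 x
    have h4 : (x.sum fun i a => x.sum fun j b => star a * ((C : ℂ) • (1 : Matrix ι ι ℂ) - W) i j * b)
        = (x.sum fun i a => x.sum fun j b => star a * ((C : ℂ) • (1 : Matrix ι ι ℂ)) i j * b)
          - B x x := by
      simp only [B, ← Finsupp.sum_sub]
      refine Finsupp.sum_congr fun i _ => Finsupp.sum_congr fun j _ => ?_
      rw [Matrix.sub_apply]; ring
    rw [h4, ← h2] at h3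
    have h5 := (Complex.le_def.1 h3).1
    simp only [smul_apply, one_apply_eq_self, inner_smul_right,
      inner_self_eq_norm_sq_to_K] at h5
    have h6 : ((C : ℂ) * ((‖finVec ι x‖ : ℝ) : ℂ) ^ 2).re = C * ‖finVec ι x‖ ^ 2 := by
      norm_cast
    rw [Complex.sub_re] at h5
    change 0 ≤ ((C : ℂ) * ((‖finVec ι x‖ : ℝ) : ℂ) ^ 2).re - _ at h5
    rw [h6] at h5
    simpa using h5
  -- Expand `0 ≤ B (x - y) (x - y)`; this replaces Cauchy–Schwarz for `B`.
  have key : ∀ x y, 2 * (B y x).re ≤ C * ‖finVec ι x‖ ^ 2 + C * ‖finVec ι y‖ ^ 2 := by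
    intro x y
    have h := (Complex.le_def.1 (hW.2 (x - y))).1
    change 0 ≤ (B (x - y) (x - y)).re at h
    rw [hBsub, hBsymm x y] at h
    simp at h
    linarith [hnorm x, hnorm y]
  have hcol : ∀ j, Memℓp (fun i => W i j) 2 := by
    intro j
    refine memℓp_gen' (C := C ^ 2) fun s => ?_
    -- Testing `key` against the truncated column scaled by `C⁻¹` balances both sides and bounds its
    -- squared norm by `C²`.
    let y : ι →₀ ℂ := ∑ i ∈ s, .single i ((C : ℂ)⁻¹ * W i j)
    have hy : finVec ι y = ∑ i ∈ s, ((C : ℂ)⁻¹ * W i j) • ket i := by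
      simp only [finVec, y, map_sum, Finsupp.linearCombination_single]
    have hyn : ‖finVec ι y‖ ^ 2 = C⁻¹ ^ 2 * ∑ i ∈ s, ‖W i j‖ ^ 2 := by
      have := lp.norm_sum_single (E := fun _ : ι => ℂ) (p := 2) (by simp)
        (fun i => (C : ℂ)⁻¹ * W i j) s
      rw [hy, Finset.mul_sum]
      simp only [ENNReal.toReal_ofNat, Real.rpow_ofNat] at this
      convert this using 3 with i hi i hi
      · refine Finset.sum_congr rfl fun i _ => ?_
        refine lp.ext (funext fun k => ?_)
        rcases eq_or_ne k i with rfl | h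
        · simp [ket_apply_self]
        · simp [ket_apply_ne h, h]
      · rw [norm_mul, mul_pow, norm_inv, Complex.norm_real, Real.norm_of_nonneg hC0.le]
    have hB : B y (.single j 1) = (C⁻¹ * ∑ i ∈ s, ‖W i j‖ ^ 2 : ℝ) := by
      simp only [B]
      have : ∀ i a, ((Finsupp.single j (1 : ℂ)).sum fun j b => star a * W i j * b)
          = star a * W i j := by
        intro i a; simp
      simp only [this]
      simp only [y]
      rw [← Finsupp.sum_finsetSum_index (by simp) (by intros; simp [add_mul])]
      push_cast
      rw [Finset.mul_sum]
      refine Finset.sum_congr rfl fun i _ => ?_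
      rw [Finsupp.sum_single_index (by simp), ← Complex.conj_mul']
      simp
      ring
    have h := key (.single j 1) y
    rw [hB, hyn, finVec_single, norm_ket, Complex.ofReal_re] at h
    simp only [ENNReal.toReal_ofNat, Real.rpow_ofNat]
    have h2 : C * (C⁻¹ ^ 2 * ∑ i ∈ s, ‖W i j‖ ^ 2) = C⁻¹ * ∑ i ∈ s, ‖W i j‖ ^ 2 := by
      field_simp
    rw [h2] at h
    have h3 : C⁻¹ * ∑ i ∈ s, ‖W i j‖ ^ 2 ≤ C := by linarith
    rw [inv_mul_le_iff₀ hC0] at h3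
    nlinarith
  let f : (ι →₀ ℂ) →ₗ[ℂ] ℓ²(ι, ℂ) :=
    Finsupp.linearCombination ℂ fun j => (⟨fun i => W i j, hcol j⟩ : ℓ²(ι, ℂ))
  have hfB : ∀ x y, ⟪finVec ι y, f x⟫_ℂ = B y x := by
    intro x y
    rw [inner_finVec_left]
    refine Finsupp.sum_congr fun i _ => ?_
    simp only [f, Finsupp.linearCombination_apply]
    rw [Finsupp.sum, lp.coeFn_sum, Finset.sum_apply, Finset.mul_sum]
    refine Finset.sum_congr rfl fun j _ => ?_
    rw [lp.coeFn_smul, Pi.smul_apply, smul_eq_mul]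
    ring
  have hfle : ∀ x, ‖f x‖ ≤ C * ‖finVec ι x‖ := by
    intro x
    have h : ∀ v : ℓ²(ι, ℂ), 2 * (⟪v, f x⟫_ℂ).re ≤ C * ‖finVec ι x‖ ^ 2 + C * ‖v‖ ^ 2 := by
      intro v
      refine (denseRange_finVec ι).induction_on
        (p := fun v => 2 * (⟪v, f x⟫_ℂ).re ≤ C * ‖finVec ι x‖ ^ 2 + C * ‖v‖ ^ 2) v ?_ fun y => ?_
      · refine isClosed_le ?_ (by fun_prop)
        have : Continuous fun v => ⟪v, f x⟫_ℂ := by fun_prop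
        exact continuous_const.mul (Complex.continuous_re.comp this)
      · rw [hfB]
        exact key x y
    -- The same scaling, with `v = C⁻¹ f x`, yields `‖f x‖ ≤ C ‖x‖`.
    have h1 := h (((C⁻¹ : ℝ) : ℂ) • f x)
    rw [inner_smul_left, inner_self_eq_norm_sq_to_K, norm_smul, Complex.norm_real,
      Real.norm_of_nonneg (inv_nonneg.2 hC0.le)] at h1
    have h2 : ((starRingEnd ℂ) ((C⁻¹ : ℝ) : ℂ) * ((‖f x‖ : ℝ) : ℂ) ^ 2).re = C⁻¹ * ‖f x‖ ^ 2 := by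
      rw [Complex.conj_ofReal]
      norm_cast
    change 2 * ((starRingEnd ℂ) ((C⁻¹ : ℝ) : ℂ) * ((‖f x‖ : ℝ) : ℂ) ^ 2).re ≤ _ at h1
    rw [h2] at h1
    have h3 : C * (C⁻¹ * ‖f x‖) ^ 2 = C⁻¹ * ‖f x‖ ^ 2 := by field_simp
    rw [h3] at h1
    have h4 : C⁻¹ * ‖f x‖ ^ 2 ≤ C * ‖finVec ι x‖ ^ 2 := by linarith
    rw [inv_mul_le_iff₀ hC0] at h4
    refine (pow_le_pow_iff_left₀ (norm_nonneg _) (by positivity) two_ne_zero).1 ?_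
    linarith
  refine ⟨f.extendOfNorm (finVec ι), fun i j => ?_⟩
  rw [← finVec_single, LinearMap.extendOfNorm_eq (denseRange_finVec ι) ⟨C, hfle⟩]
  simp [f]

/-! ### Trace-class matrices -/

theorem diag_eq_norm {ι : Type*} {X : Matrix ι ι ℂ} (hX : X.PosSemidef) (i : ι) :
    X i i = (‖X i i‖ : ℂ) :=
  Complex.eq_coe_norm_of_nonneg hX.diag_nonneg

theorem norm_entry_sq_le {ι : Type*} {X : Matrix ι ι ℂ} (hX : X.PosSemidef) (i j : ι) :
    ‖X i j‖ ^ 2 ≤ ‖X i i‖ * ‖X j j‖ := by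
  have h := (hX.submatrix ![i, j]).det_nonneg
  rw [Matrix.det_fin_two] at h
  simp only [Matrix.submatrix_apply, Matrix.cons_val_zero, Matrix.cons_val_one] at h
  rw [← hX.1.apply j i, Complex.star_def, Complex.mul_conj', diag_eq_norm hX i,
    diag_eq_norm hX j] at h
  norm_cast at h
  linarith

/-- A positive semidefinite matrix of finite trace is bounded by its trace. -/
theorem posSemidef_trace_smul_one_sub {ι : Type*} [DecidableEq ι] {X : Matrix ι ι ℂ}
    (hX : X.PosSemidef) (hs : Summable fun i => X i i) :
    (((∑' i, ‖X i i‖ : ℝ) : ℂ) • (1 : Matrix ι ι ℂ) - X).PosSemidef := by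
  set t : ℝ := ∑' i, ‖X i i‖ with ht
  have hH : ((t : ℂ) • (1 : Matrix ι ι ℂ) - X).IsHermitian := by
    refine Matrix.IsHermitian.sub ?_ hX.1
    ext i j
    simp [Matrix.conjTranspose_apply, Matrix.one_apply, eq_comm]
    split_ifs <;> simp
  refine ⟨hH, fun x => ?_⟩
  have h1 : (x.sum fun i a => x.sum fun j b => star a * ((t : ℂ) • (1 : Matrix ι ι ℂ) - X) i j * b)
      = ((t * ∑ i ∈ x.support, ‖x i‖ ^ 2 : ℝ) : ℂ)
        - x.sum fun i a => x.sum fun j b => star a * X i j * b := by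
    simp only [Finsupp.sum]
    push_cast
    rw [Finset.mul_sum, ← Finset.sum_sub_distrib]
    refine Finset.sum_congr rfl fun i hi => ?_
    have : (t : ℂ) * (‖x i‖ : ℂ) ^ 2
        = ∑ j ∈ x.support, star (x i) * ((t : ℂ) • (1 : Matrix ι ι ℂ)) i j * x j := by
      rw [Finset.sum_eq_single_of_mem i hi]
      · rw [← Complex.conj_mul']
        simp
        ring
      · intro j _ hj
        simp [Matrix.one_apply_ne hj.symm]
    rw [this, ← Finset.sum_sub_distrib]
    refine Finset.sum_congr rfl fun j _ => ?_
    rw [Matrix.sub_apply]; ring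
  rw [h1, sub_nonneg]
  have h0 := hX.2 x
  rw [Complex.eq_coe_norm_of_nonneg h0, Complex.real_le_real]
  -- Cauchy–Schwarz, using `|X i j| ≤ √(X i i) √(X j j)`.
  calc ‖x.sum fun i a => x.sum fun j b => star a * X i j * b‖
      ≤ ∑ i ∈ x.support, ∑ j ∈ x.support, (‖x i‖ * √‖X i i‖) * (‖x j‖ * √‖X j j‖) := by
        refine (norm_sum_le _ _).trans (Finset.sum_le_sum fun i _ => ?_)
        refine (norm_sum_le _ _).trans (Finset.sum_le_sum fun j _ => ?_)
        have : ‖X i j‖ ≤ √‖X i i‖ * √‖X j j‖ := by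
          rw [← Real.sqrt_mul (norm_nonneg _)]
          exact Real.le_sqrt_of_sq_le (norm_entry_sq_le hX i j)
        calc ‖star (x i) * X i j * x j‖ = (‖x i‖ * ‖x j‖) * ‖X i j‖ := by
              simp only [norm_mul, norm_star]; ring
          _ ≤ (‖x i‖ * ‖x j‖) * (√‖X i i‖ * √‖X j j‖) := by gcongr
          _ = _ := by ring
    _ = (∑ i ∈ x.support, ‖x i‖ * √‖X i i‖) ^ 2 := by
        rw [sq, Finset.sum_mul_sum]
    _ ≤ (∑ i ∈ x.support, ‖x i‖ ^ 2) * ∑ i ∈ x.support, √‖X i i‖ ^ 2 :=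
        Finset.sum_mul_sq_le_sq_mul_sq _ _ _
    _ ≤ (∑ i ∈ x.support, ‖x i‖ ^ 2) * t := by
        gcongr
        simp only [Real.sq_sqrt (norm_nonneg _)]
        exact hs.norm.sum_le_tsum _ fun i _ => norm_nonneg _
    _ = _ := mul_comm _ _

theorem exists_hasMatrix_of_mem {ι : Type*} {X : Matrix ι ι ℂ} (hX : X ∈ TraceClass ι) :
    ∃ T, HasMatrix T X := by
  classical
  unfold TraceClass at hX
  induction hX using Submodule.span_induction with
  | mem X h => exact exists_hasMatrix h.1 (posSemidef_trace_smul_one_sub h.1 h.2)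
  | zero => exact ⟨0, fun i j => by simp⟩
  | add X Y _ _ hX hY =>
    obtain ⟨S, hS⟩ := hX
    obtain ⟨T, hT⟩ := hY
    exact ⟨_, hS.add hT⟩
  | smul c X _ hX =>
    obtain ⟨S, hS⟩ := hX
    exact ⟨_, hS.smul c⟩

theorem hasMatrix_toOp_of_mem {ι : Type*} {X : Matrix ι ι ℂ} (hX : X ∈ TraceClass ι) :
    HasMatrix (toOp X) X :=
  hasMatrix_toOp (exists_hasMatrix_of_mem hX)

theorem summable_diag {ι : Type*} {X : Matrix ι ι ℂ} (hX : X ∈ TraceClass ι) :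
    Summable fun i => X i i := by
  unfold TraceClass at hX
  induction hX using Submodule.span_induction with
  | mem X h => exact h.2
  | zero => simp
  | add X Y _ _ hX hY => exact hX.add hY
  | smul c X _ hX => exact hX.mul_left c

/-! ### The trace of a product -/

theorem summable_norm_sq_apply {ι κ : Type*} {u : ι → ℓ²(κ, ℂ)}
    (hu : Summable fun j => ‖u j‖ ^ 2) : Summable fun p : κ × ι => ‖u p.2 p.1‖ ^ 2 := by
  have hsum : ∀ j, HasSum (fun i => ‖u j i‖ ^ 2) (‖u j‖ ^ 2) := fun j => by
    simpa using lp.hasSum_norm (p := 2) (by simp) (u j)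
  have h : Summable fun p : ι × κ => ‖u p.1 p.2‖ ^ 2 := by
    rw [summable_prod_of_nonneg fun p => by positivity]
    exact ⟨fun j => (hsum j).summable, by simpa only [(hsum _).tsum_eq] using hu⟩
  exact h.prod_symm

theorem exists_nonneg_sqrt {E : Type*} [NormedAddCommGroup E] [InnerProductSpace ℂ E]
    [CompleteSpace E] {T : E →L[ℂ] E} (hT : 0 ≤ T) : ∃ Q : E →L[ℂ] E, 0 ≤ Q ∧ Q * Q = T :=
  ⟨CFC.sqrt T, CFC.sqrt_nonneg _, CFC.sqrt_mul_sqrt_self _ hT⟩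

/-- The trace of a product of a positive trace-class operator and a positive bounded operator is
nonnegative. -/
theorem exists_hasSum_trace_mul {ι : Type*} {X : Matrix ι ι ℂ} (hX : X.PosSemidef)
    (hs : Summable fun i => X i i) {S : ℓ²(ι, ℂ) →L[ℂ] ℓ²(ι, ℂ)} (hS : 0 ≤ S) :
    ∃ r : ℂ, 0 ≤ r ∧ HasSum (fun i => toOp X (S (ket i)) i) r := by
  have hM := hasMatrix_toOp_of_mem (Submodule.subset_span ⟨hX, hs⟩ : X ∈ TraceClass ι)
  have hpos := hM.nonneg hX
  obtain ⟨Q, hQ0, hQQ⟩ := exists_nonneg_sqrt hpos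
  have hQs := ((ContinuousLinearMap.nonneg_iff_isPositive _).1 hQ0).inner_left_eq_inner_right
  have hSp := (ContinuousLinearMap.nonneg_iff_isPositive _).1 hS
  have hSs := hSp.inner_left_eq_inner_right
  have hQn : Summable fun j => ‖Q (ket j)‖ ^ 2 := by
    refine (hs.norm).congr fun j => ?_
    have h1 : ⟪Q (ket j), Q (ket j)⟫_ℂ = X j j := by
      rw [hQs, ← hM j j, ← hQQ, inner_ket_left]
      rfl
    rw [inner_self_eq_norm_sq_to_K] at h1
    rw [← h1]
    simp
  have hSQn : Summable fun j => ‖S (Q (ket j))‖ ^ 2 := by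
    refine (hQn.mul_left (‖S‖ ^ 2)).of_nonneg_of_le (fun j => by positivity) fun j => ?_
    rw [← mul_pow]
    gcongr
    exact S.le_opNorm _
  -- With `Q = √X`, both `Q` and `S Q` are Hilbert–Schmidt, so `G` is absolutely summable. Its row
  -- sums are the diagonal entries of `X S`, its column sums are `⟨S Q e_j, Q e_j⟩ ≥ 0`, and the two
  -- orders of summation agree.
  let G : ι × ι → ℂ := fun p => Q (ket p.2) p.1 * star (S (Q (ket p.2)) p.1)
  have hG : Summable G := by
    refine Summable.of_norm_bounded
      ((summable_norm_sq_apply hQn).add (summable_norm_sq_apply hSQn)) fun p => ?_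
    rw [norm_mul, norm_star]
    nlinarith [sq_nonneg (‖Q (ket p.2) p.1‖ - ‖S (Q (ket p.2)) p.1‖),
      sq_nonneg (‖Q (ket p.2) p.1‖ + ‖S (Q (ket p.2)) p.1‖)]
  have hrow : ∀ i, HasSum (fun j => G (i, j)) (toOp X (S (ket i)) i) := by
    intro i
    have h1 : toOp X (S (ket i)) i = ⟪Q (ket i), Q (S (ket i))⟫_ℂ := by
      rw [hQs, ← hQQ, inner_ket_left]
      rfl
    rw [h1]
    have e : (fun j => G (i, j)) = fun j => ⟪Q (ket i) j, Q (S (ket i)) j⟫_ℂ := by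
      ext j
      have h2 : Q (S (ket i)) j = star (S (Q (ket j)) i) := by
        rw [← inner_ket_left, ← hQs, ← hSs, inner_ket_right]
      have h3 : Q (ket i) j = star (Q (ket j) i) := by
        rw [← inner_ket_left, ← hQs, inner_ket_right]
      rw [h2, h3]
      simp [G, mul_comm]
    rw [e]
    exact lp.hasSum_inner (𝕜 := ℂ) (Q (ket i)) (Q (S (ket i)))
  have hcol : ∀ j, HasSum (fun i => G (i, j)) ⟪S (Q (ket j)), Q (ket j)⟫_ℂ := by
    intro j
    exact lp.hasSum_inner (𝕜 := ℂ) (S (Q (ket j))) (Q (ket j))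
  refine ⟨_, ?_, hG.hasSum.prod_fiberwise hrow⟩
  have h := hG.prod_symm.hasSum.prod_fiberwise hcol
  have e : ∑' b : ι × ι, G b = ∑' b : ι × ι, G b.swap :=
    ((Equiv.prodComm ι ι).tsum_eq G).symm
  rw [e]
  exact h.nonneg fun j => hSp.inner_nonneg_left _

/-- If `X` is a density operator and `T ≤ c`, then `tr(X T) ≤ c`. -/
theorem re_trace_mul_le {ι : Type*} {X : Matrix ι ι ℂ} (hX : X.PosSemidef)
    (hs : HasSum (fun i => X i i) 1) {T : ℓ²(ι, ℂ) →L[ℂ] ℓ²(ι, ℂ)} {c : ℝ}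
    (hT : T ≤ (c : ℂ) • 1) : ∑' i, (toOp X (T (ket i)) i).re ≤ c := by
  obtain ⟨r, hr, hsum⟩ := exists_hasSum_trace_mul hX hs.summable (sub_nonneg.2 hT)
  have hM := hasMatrix_toOp_of_mem (Submodule.subset_span ⟨hX, hs.summable⟩ : X ∈ TraceClass ι)
  -- Here `r = tr(X (c - T)) ≥ 0` and `tr X = 1`.
  have h1 : HasSum (fun i => toOp X (T (ket i)) i) (c * 1 - r) := by
    have e : (fun i => toOp X (T (ket i)) i)
        = fun i => c * X i i - toOp X (((c : ℂ) • 1 - T) (ket i)) i := by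
      ext i
      have h : ((c : ℂ) • 1 - T) (ket i) = (c : ℂ) • ket i - T (ket i) := rfl
      rw [← hM i i, h, map_sub, map_smul, lp.coeFn_sub, Pi.sub_apply, lp.coeFn_smul, Pi.smul_apply,
        smul_eq_mul, sub_sub_cancel]
    rw [e]
    exact (hs.mul_left (c : ℂ)).sub hsum
  have h2 := Complex.hasSum_re h1
  rw [h2.tsum_eq]
  have := (Complex.le_def.1 hr).1
  simp at this ⊢
  exact this

/-! ### Operator inequalities for the logarithm -/

section Log

variable {𝒜 : Type*} [CStarAlgebra 𝒜] [PartialOrder 𝒜] [StarOrderedRing 𝒜]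

theorem isStrictlyPositive_add_smul_one {P : 𝒜} (hP : 0 ≤ P) {ε : ℝ} (hε : 0 < ε) :
    IsStrictlyPositive (P + ε • (1 : 𝒜)) := by
  have h1 : IsStrictlyPositive (ε • (1 : 𝒜)) := IsStrictlyPositive.smul hε isStrictlyPositive_one
  exact h1.of_le (le_add_of_nonneg_left hP)

/-- Since `d ≥ 1`, the shift by `ε` preserves the inequality: `P + ε ≤ d (Q + ε)`. The logarithm is
operator monotone and turns the factor `d` into the summand `log d`. -/
theorem log_sub_log_le {P Q : 𝒜} (hP : 0 ≤ P) (hQ : 0 ≤ Q) {d ε : ℝ} (hd : 1 ≤ d) (hε : 0 < ε)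
    (h : P ≤ d • Q) :
    CFC.log (P + ε • (1 : 𝒜)) - CFC.log (Q + ε • (1 : 𝒜)) ≤ Real.log d • (1 : 𝒜) := by
  have h1 : P + ε • (1 : 𝒜) ≤ d • (Q + ε • (1 : 𝒜)) := by
    rw [smul_add, smul_smul]
    refine add_le_add h (smul_le_smul_of_nonneg_right ?_ zero_le_one)
    nlinarith
  have h2 := CFC.log_le_log h1 (isStrictlyPositive_add_smul_one hP hε)
  rw [CFC.log_smul' _ (by linarith) (isStrictlyPositive_add_smul_one hQ hε),
    Algebra.algebraMap_eq_smul_one] at h2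
  rwa [sub_le_iff_le_add]

/-- By concavity, the logarithm lies below its tangent at `c`. -/
theorem log_le_tangent {Q : 𝒜} (hQ : IsStrictlyPositive Q) {c : ℝ} (hc : 0 < c) :
    CFC.log Q ≤ (Real.log c - 1) • (1 : 𝒜) + c⁻¹ • Q := by
  have hsa : IsSelfAdjoint Q := hQ.isSelfAdjoint
  have h : (Real.log c - 1) • (1 : 𝒜) + c⁻¹ • Q
      = cfc (fun x : ℝ => (Real.log c - 1) + c⁻¹ * x) Q := by
    rw [cfc_const_add .., cfc_const_mul_id .., Algebra.algebraMap_eq_smul_one]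
  have hpos : ∀ x ∈ spectrum ℝ Q, 0 < x := fun x hx => hQ.spectrum_pos hx
  rw [h, CFC.log]
  refine cfc_mono (fun x hx => ?_)
    (Real.continuousOn_log.mono fun x hx => by simpa using (hpos x hx).ne') (by fun_prop)
  have hx0 := hpos x hx
  have := Real.log_le_sub_one_of_pos (x := c⁻¹ * x) (by positivity)
  rw [Real.log_mul (by positivity) hx0.ne', Real.log_inv] at this
  linarith

/-- By concavity, `x ↦ log (x + ε)` lies above its chord over `[0, 1]`, which contains the spectrum
of `P`. -/
theorem chord_le_log {P : 𝒜} (hP : 0 ≤ P) (hP1 : P ≤ 1) {ε : ℝ} (hε : 0 < ε) :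
    Real.log ε • (1 : 𝒜) + (Real.log (1 + ε) - Real.log ε) • P ≤ CFC.log (P + ε • (1 : 𝒜)) := by
  have hsa : IsSelfAdjoint P := hP.isSelfAdjoint
  have h : Real.log ε • (1 : 𝒜) + (Real.log (1 + ε) - Real.log ε) • P
      = cfc (fun x : ℝ => Real.log ε + (Real.log (1 + ε) - Real.log ε) * x) P := by
    rw [cfc_const_add .., cfc_const_mul_id .., Algebra.algebraMap_eq_smul_one]
  have h2 : P + ε • (1 : 𝒜) = cfc (fun x : ℝ => x + ε) P := by
    rw [cfc_add_const .., cfc_id' .., Algebra.algebraMap_eq_smul_one]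
  have hpos : ∀ x ∈ spectrum ℝ P, 0 ≤ x := fun x hx => spectrum_nonneg_of_nonneg hP hx
  have hle : ∀ x ∈ spectrum ℝ P, x ≤ 1 := by
    have : P ≤ algebraMap ℝ 𝒜 1 := by simpa using hP1
    exact (le_algebraMap_iff_spectrum_le).1 this
  have hcont : ContinuousOn (fun x : ℝ => Real.log (x + ε)) (spectrum ℝ P) := by
    refine ContinuousOn.log (by fun_prop) fun x hx => ?_
    have := hpos x hx
    positivity
  have h3 : CFC.log (P + ε • (1 : 𝒜)) = cfc (fun x : ℝ => Real.log (x + ε)) P := by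
    rw [h2, CFC.log, ← cfc_comp' Real.log (fun x : ℝ => x + ε) P ?_]
    refine Real.continuousOn_log.mono ?_
    rintro _ ⟨x, hx, rfl⟩
    have := hpos x hx
    simp
    positivity
  rw [h, h3]
  refine cfc_mono (fun x hx => ?_) (by fun_prop) hcont
  have hε1 : 0 < 1 + ε := by positivity
  have hc := strictConcaveOn_log_Ioi.concaveOn.2 (Set.mem_Ioi.2 hε) (Set.mem_Ioi.2 hε1)
    (sub_nonneg.2 (hle x hx)) (hpos x hx) (by ring)
  simp only [smul_eq_mul] at hc
  have e : (1 - x) * ε + x * (1 + ε) = x + ε := by ring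
  rw [e] at hc
  linarith

end Log

theorem log_sub_log_le_op {ι : Type*} {P Q : ℓ²(ι, ℂ) →L[ℂ] ℓ²(ι, ℂ)} (hP : 0 ≤ P) (hQ : 0 ≤ Q)
    {d ε : ℝ} (hd : 1 ≤ d) (hε : 0 < ε) (h : P ≤ (d : ℂ) • Q) :
    CFC.log (P + ε • 1) - CFC.log (Q + ε • 1) ≤ (Real.log d : ℂ) • 1 :=
  log_sub_log_le hP hQ hd hε h

theorem log_le_tangent_op {ι : Type*} {Q : ℓ²(ι, ℂ) →L[ℂ] ℓ²(ι, ℂ)} (hQ : 0 ≤ Q)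
    {c ε : ℝ} (hc : 0 < c) (hε : 0 < ε) :
    CFC.log (Q + ε • 1) ≤ ((Real.log c - 1 : ℝ) : ℂ) • 1 + ((c⁻¹ : ℝ) : ℂ) • (Q + (ε : ℂ) • 1) :=
  log_le_tangent (isStrictlyPositive_add_smul_one hQ hε) hc

theorem chord_le_log_op {ι : Type*} {P : ℓ²(ι, ℂ) →L[ℂ] ℓ²(ι, ℂ)} (hP : 0 ≤ P) (hP1 : P ≤ 1)
    {ε : ℝ} (hε : 0 < ε) :
    (Real.log ε : ℂ) • 1 + ((Real.log (1 + ε) - Real.log ε : ℝ) : ℂ) • P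
      ≤ CFC.log (P + ε • 1) :=
  chord_le_log hP hP1 hε

/-! ### Upper bound for the relative entropy from an operator inequality -/

theorem regRelEntropy_eq {ι : Type*} (ρ σ : Matrix ι ι ℂ) (ε : ℝ) :
    regRelEntropy ρ σ ε = (∑' i, (toOp ρ ((CFC.log (toOp ρ + ε • 1)
      - CFC.log (toOp σ + ε • 1)) (ket i)) i).re) / Real.log 2 := rfl

/-- If `ρ ≤ d σ`, then `D(ρ‖σ) ≤ log d`. -/
theorem relEntropy_le_logb {ι : Type*} {ρ σ : Matrix ι ι ℂ} (hρ : ρ.PosSemidef)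
    (htr : HasSum (fun i => ρ i i) 1) (hσ : σ.PosSemidef) (hex : ∃ T, HasMatrix T σ) {d : ℝ}
    (hd : 1 ≤ d) (h : ((d : ℂ) • σ - ρ).PosSemidef) :
    relEntropy ρ σ ≤ (Real.logb 2 d : ℝ) := by
  have hmρ := hasMatrix_toOp_of_mem (Submodule.subset_span ⟨hρ, htr.summable⟩ : ρ ∈ TraceClass ι)
  have hmσ := hasMatrix_toOp hex
  refine Filter.limsup_le_of_le (by isBoundedDefault) ?_
  filter_upwards [self_mem_nhdsWithin] with ε hε
  rw [EReal.coe_le_coe_iff, regRelEntropy_eq, Real.logb]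
  gcongr
  refine re_trace_mul_le hρ htr (log_sub_log_le_op (hmρ.nonneg hρ) (hmσ.nonneg hσ) hd hε ?_)
  exact sub_nonneg.1 (((hmσ.smul _).sub hmρ).nonneg h)

/-! ### Positive semidefinite matrices with infinitely many entries -/

/-- Each test vector has finite support, so it sees only a finite block of `X`. -/
theorem posSemidef_of_forall_finset {ι : Type*} {X : Matrix ι ι ℂ}
    (h : ∀ s : Finset ι, ∃ Y : Matrix ι ι ℂ, Y.PosSemidef ∧ ∀ i ∈ s, ∀ j ∈ s, X i j = Y i j) :
    X.PosSemidef := by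
  classical
  refine ⟨?_, fun x => ?_⟩
  · ext i j
    obtain ⟨Y, hY, e⟩ := h {i, j}
    rw [Matrix.conjTranspose_apply, e j (by simp) i (by simp), e i (by simp) j (by simp)]
    exact hY.1.apply i j
  · obtain ⟨Y, hY, e⟩ := h x.support
    convert hY.2 x using 1
    exact Finset.sum_congr rfl fun i hi => Finset.sum_congr rfl fun j hj => by
      simp only [e i hi j hj]

theorem _root_.Matrix.PosSemidef.diagonal_conj {ι : Type*} {X : Matrix ι ι ℂ} (hX : X.PosSemidef)
    (c : ι → ℝ) : (Matrix.of fun i j => (c i : ℂ) * X i j * (c j : ℂ)).PosSemidef := by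
  refine ⟨?_, fun x => ?_⟩
  · ext i j
    simp only [Matrix.conjTranspose_apply, Matrix.of_apply, star_mul', hX.1.apply]
    simp
    ring
  · have h := hX.2 (Finsupp.onFinset x.support (fun i => (c i : ℂ) * x i)
      fun i hi => by simpa using right_ne_zero_of_mul hi)
    rw [Finsupp.onFinset_sum _ (by simp)] at h
    convert h using 1
    refine Finset.sum_congr rfl fun i _ => ?_
    rw [Finsupp.onFinset_sum _ (by simp)]
    refine Finset.sum_congr rfl fun j _ => ?_
    simp only [Matrix.of_apply, star_mul', Complex.star_def, Complex.conj_ofReal]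
    ring

/-- The operator `1_A ⊗ P` on `R × (A × B)`. -/
def idTensor {R B : Type*} (A : Type*) [DecidableEq A] (P : Matrix (R × B) (R × B) ℂ) :
    Matrix (R × (A × B)) (R × (A × B)) ℂ :=
  Matrix.of fun p q => if p.2.1 = q.2.1 then P (p.1, p.2.2) (q.1, q.2.2) else 0

theorem posSemidef_idTensor {R A B : Type*} [DecidableEq A] {P : Matrix (R × B) (R × B) ℂ}
    (hP : P.PosSemidef) : (idTensor A P).PosSemidef := by
  classical
  refine posSemidef_of_forall_finset fun s => ?_
  let g : R × (A × B) → R × B := fun p => (p.1, p.2.2)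
  -- `1_A ⊗ P` is the sum of the positive pieces `|a⟩⟨a| ⊗ P`; on the finite block `s` only finitely
  -- many labels `a` occur, even if `A` is infinite.
  refine ⟨∑ a ∈ s.image fun p => p.2.1, Matrix.of fun p q =>
    (((if p.2.1 = a then 1 else 0 : ℝ)) : ℂ) * (P.submatrix g g) p q
      * ((if q.2.1 = a then 1 else 0 : ℝ) : ℂ),
    Matrix.posSemidef_sum _ fun a _ => (hP.submatrix g).diagonal_conj _, fun p hp q hq => ?_⟩
  rw [Matrix.sum_apply, Finset.sum_eq_single_of_mem p.2.1 (Finset.mem_image.2 ⟨p, hp, rfl⟩)]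
  · by_cases h : p.2.1 = q.2.1
    · simp [idTensor, g, h]
    · simp [idTensor, h, Ne.symm h]
  · intro a _ ha
    simp [Ne.symm ha]

theorem smul_one_sub_idTensor {R A B : Type*} [DecidableEq R] [DecidableEq A] [DecidableEq B]
    (P : Matrix (R × B) (R × B) ℂ) (c : ℂ) :
    c • (1 : Matrix (R × (A × B)) (R × (A × B)) ℂ) - idTensor A P = idTensor A (c • 1 - P) := by
  ext ⟨r, a, b⟩ ⟨r', a', b'⟩
  by_cases h : a = a' <;> simp [idTensor, Matrix.one_apply, h]

theorem exists_hasMatrix_idTensor {R A B : Type*} [DecidableEq A] {P : Matrix (R × B) (R × B) ℂ}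
    (hP : P.PosSemidef) (hs : Summable fun i => P i i) : ∃ T, HasMatrix T (idTensor A P) := by
  classical
  refine exists_hasMatrix (posSemidef_idTensor hP) (C := ∑' i, ‖P i i‖) ?_
  rw [smul_one_sub_idTensor]
  exact posSemidef_idTensor (posSemidef_trace_smul_one_sub hP hs)

/-- `ω ≤ |A| (1_A ⊗ tr_A ω)`. -/
theorem posSemidef_card_smul_idTensor_sub {R A B : Type*} [Fintype A] [DecidableEq A]
    {X : Matrix (R × (A × B)) (R × (A × B)) ℂ} (hX : X.PosSemidef) :
    ((Fintype.card A : ℂ) • idTensor A (Matrix.of fun p q =>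
      ∑ a, X (p.1, (a, p.2)) (q.1, (a, q.2))) - X).PosSemidef := by
  let δ : A → R × (A × B) → ℝ := fun a p => if p.2.1 = a then 1 else 0
  let g : A → R × (A × B) → R × (A × B) := fun a p => (p.1, (a, p.2.2))
  -- With `Π_a = |a⟩⟨a|`, the first sum is `½ ∑ (Π_a - Π_b) X (Π_a - Π_b) = |A| ∑ Π_a X Π_a - X`.
  -- The second is `|A|` times the terms `b ≠ a` of `1_A ⊗ tr_A X = ∑ |a⟩⟨b| X |b⟩⟨a|`, whose terms
  -- `b = a` are the `Π_a X Π_a`.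
  have e : (Fintype.card A : ℂ) • idTensor A (Matrix.of fun p q =>
      ∑ a, X (p.1, (a, p.2)) (q.1, (a, q.2))) - X
      = (1 / 2 : ℂ) • (∑ a : A, ∑ b : A, Matrix.of fun p q =>
          ((δ a p - δ b p : ℝ) : ℂ) * X p q * ((δ a q - δ b q : ℝ) : ℂ))
        + (Fintype.card A : ℂ) • ∑ a : A, ∑ b ∈ Finset.univ.erase a, Matrix.of fun p q =>
          (δ a p : ℂ) * (X.submatrix (g b) (g b)) p q * (δ a q : ℂ) := by
    ext p q
    have hδc : ∀ a p, (δ a p : ℂ) = if p.2.1 = a then 1 else 0 := fun a p => by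
      simp only [δ]; split_ifs <;> simp
    have hδ : ∀ p, ∑ a, (δ a p : ℂ) = 1 := fun p => by simp [hδc]
    have hδδ : ∑ a, (δ a p : ℂ) * (δ a q : ℂ) = if p.2.1 = q.2.1 then 1 else 0 := by
      simp [hδc, eq_comm]
    have h1 : ∑ a : A, ∑ b : A, ((δ a p - δ b p : ℝ) : ℂ) * X p q * ((δ a q - δ b q : ℝ) : ℂ)
        = X p q * (2 * Fintype.card A * (if p.2.1 = q.2.1 then 1 else 0) - 2) := by
      have : ∀ a b : A, ((δ a p - δ b p : ℝ) : ℂ) * X p q * ((δ a q - δ b q : ℝ) : ℂ)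
          = X p q * ((δ a p * δ a q + δ b p * δ b q) - (δ a p * δ b q + δ b p * δ a q)) := by
        intro a b; push_cast; ring
      simp only [this, ← Finset.mul_sum, Finset.sum_sub_distrib, Finset.sum_add_distrib,
        ← Finset.sum_mul, hδ, hδδ, Finset.sum_const, Finset.card_univ, nsmul_eq_mul]
      have hcard : ∑ a, (δ a p : ℂ) * ((Fintype.card A : ℂ) * (δ a q : ℂ))
          = Fintype.card A * (if p.2.1 = q.2.1 then 1 else 0) := by
        simp only [mul_left_comm _ (Fintype.card A : ℂ)]
        rw [← Finset.mul_sum, hδδ]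
      rw [hcard]
      ring
    have h2 : ∑ a : A, ∑ b ∈ Finset.univ.erase a,
        (δ a p : ℂ) * (X.submatrix (g b) (g b)) p q * (δ a q : ℂ)
        = (if p.2.1 = q.2.1 then 1 else 0) *
          (∑ b, X (p.1, (b, p.2.2)) (q.1, (b, q.2.2)) - X p q) := by
      rw [Finset.sum_eq_single p.2.1]
      · by_cases h : p.2.1 = q.2.1
        · rw [Finset.sum_erase_eq_sub (Finset.mem_univ _)]
          have e1 : g p.2.1 p = p := rfl
          have e2 : g p.2.1 q = q := by rw [h]
          simp only [hδc, h, if_true, Matrix.submatrix_apply, one_mul, mul_one]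
          rw [← h, e1, e2]
        · simp [hδc, h, Ne.symm h]
      · intro a _ ha
        simp [hδc, Ne.symm ha]
      · simp
    simp only [Matrix.add_apply, Matrix.sub_apply, Matrix.smul_apply, Matrix.sum_apply,
      Matrix.of_apply, h1, h2, smul_eq_mul, idTensor]
    by_cases h : p.2.1 = q.2.1
    · simp only [h, if_true]; ring
    · simp only [h, if_false]; ring
  rw [e]
  refine Matrix.PosSemidef.add (Matrix.PosSemidef.smul ?_ (by positivity))
    (Matrix.PosSemidef.smul ?_ (by positivity))
  · exact Matrix.posSemidef_sum _ fun a _ => Matrix.posSemidef_sum _ fun b _ =>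
      hX.diagonal_conj _
  · exact Matrix.posSemidef_sum _ fun a _ => Matrix.posSemidef_sum _ fun b _ =>
      (hX.submatrix _).diagonal_conj _

/-! ### Amplifications of channels -/

theorem submatrix_mem {ι κ : Type*} {X : Matrix ι ι ℂ} (hX : X ∈ TraceClass ι) {f : κ → ι}
    (hf : Function.Injective f) : X.submatrix f f ∈ TraceClass κ := by
  unfold TraceClass at hX
  induction hX using Submodule.span_induction with
  | mem X h => exact Submodule.subset_span ⟨h.1.submatrix f, h.2.comp_injective hf⟩
  | zero => exact (TraceClass κ).zero_mem
  | add X Y _ _ hX hY => exact (TraceClass κ).add_mem hX hY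
  | smul c X _ hX => exact (TraceClass κ).smul_mem c hX

/-- Complete positivity is defined with ancillas `Fin n`. A finite block of the output involves only
finitely many labels of `R`, which are renumbered by `Fin t.card`. -/
theorem posSemidef_amplify {R ι κ : Type*} {Φ : TraceClass ι →ₗ[ℂ] Matrix κ κ ℂ}
    (hΦ : IsCompletelyPositive Φ) {X : TraceClass (R × ι)} (hX : X.1.PosSemidef) :
    (amplify Φ X).PosSemidef := by
  classical
  refine posSemidef_of_forall_finset fun s => ?_
  rcases s.eq_empty_or_nonempty with rfl | ⟨p₀, hp₀⟩
  · exact ⟨0, .zero, by simp⟩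
  let t : Finset R := s.image Prod.fst
  let f : Fin t.card → R := fun k => (t.equivFin.symm k : R)
  have hf : Function.Injective f := Subtype.val_injective.comp t.equivFin.symm.injective
  have hfi : Function.Injective (Prod.map f (id : ι → ι)) := hf.prodMap Function.injective_id
  have h := hΦ t.card ⟨X.1.submatrix (Prod.map f id) (Prod.map f id), submatrix_mem X.2 hfi⟩
    (hX.submatrix _)
  have hne : Nonempty (Fin t.card) :=
    ⟨t.equivFin ⟨p₀.1, Finset.mem_image_of_mem _ hp₀⟩⟩
  have hinv : ∀ p ∈ s, f (Function.invFun f p.1) = p.1 := fun p hp =>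
    Function.invFun_eq ⟨t.equivFin ⟨p.1, Finset.mem_image_of_mem _ hp⟩, by simp [f]⟩
  refine ⟨_, h.submatrix (Prod.map (Function.invFun f) id), fun p hp q hq => ?_⟩
  have e : block (Function.invFun f p.1) (Function.invFun f q.1)
      ⟨X.1.submatrix (Prod.map f id) (Prod.map f id), submatrix_mem X.2 hfi⟩ = block p.1 q.1 X := by
    ext i j
    change X.1 (f _, i) (f _, j) = X.1 (p.1, i) (q.1, j)
    rw [hinv p hp, hinv q hq]
  change Φ (block p.1 q.1 X) p.2 q.2 = Φ (block _ _ _) p.2 q.2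
  rw [Prod.map_fst, Prod.map_fst, e]

theorem Channel.posSemidef_amplify {R ι κ : Type*} (N : Channel ι κ) {X : TraceClass (R × ι)}
    (hX : X.1.PosSemidef) : (amplify N.toOperators X).PosSemidef :=
  QChannel.posSemidef_amplify N.completelyPositive hX

theorem hasSum_tr {ι : Type*} (X : TraceClass ι) : HasSum (fun i => X.1 i i) (tr X) :=
  (summable_diag X.2).hasSum

/-- For a positive matrix it suffices to sum the diagonal fiberwise. -/
theorem hasSum_prod_of_nonneg {α β : Type*} {f : α × β → ℂ} (hf : ∀ p, 0 ≤ f p) {g : α → ℂ}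
    (hg : ∀ a, HasSum (fun b => f (a, b)) (g a)) {t : ℂ} (ht : HasSum g t) : HasSum f t := by
  have hs : Summable f := by
    have hn : ∀ p, ‖f p‖ = (f p).re := fun p => by
      have h := Complex.eq_coe_norm_of_nonneg (hf p)
      rw [h]; simp
    refine Summable.of_norm ?_
    rw [summable_prod_of_nonneg fun p => norm_nonneg _]
    refine ⟨fun a => (hg a).summable.norm, ?_⟩
    simp only [hn]
    refine (Complex.hasSum_re ht).summable.congr fun a => ?_
    rw [(Complex.hasSum_re (hg a)).tsum_eq]
  have h := hs.hasSum.prod_fiberwise hg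
  rw [ht.unique h]
  exact hs.hasSum

/-- Trace preservation on each diagonal block, summed over the reference labels; positivity
justifies the fiberwise summation. -/
theorem hasSum_diag_amplify {R ι κ : Type*} (N : Channel ι κ) {X : TraceClass (R × ι)}
    (hX : X.1.PosSemidef) : HasSum (fun p => amplify N.toOperators X p p) (tr X) := by
  refine hasSum_prod_of_nonneg (fun p => (N.posSemidef_amplify hX).diag_nonneg)
    (g := fun r => tr (block r r X)) (fun r => ?_) ?_
  · rw [← N.trace_preserving]
    exact hasSum_tr _
  · exact (hasSum_tr X).prod_fiberwise fun r => hasSum_tr (block r r X)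

/-- The partial trace over `ι` of an operator on `R × (ι × κ)`. -/
def middleTrace {R ι κ : Type*} (X : TraceClass (R × (ι × κ))) : TraceClass (R × κ) :=
  partialTrace ι (R × κ) ⟨X.1.submatrix (fun p => (p.2.1, (p.1, p.2.2)))
    (fun p => (p.2.1, (p.1, p.2.2))), submatrix_mem X.2 fun p q h => by
      simp only [Prod.mk.injEq] at h
      exact Prod.ext h.2.1 (Prod.ext h.1 h.2.2)⟩

theorem partialTrace_apply {ι κ : Type*} (X : TraceClass (ι × κ)) (k l : κ) :
    (partialTrace ι κ X).1 k l = ∑' i, X.1 (i, k) (i, l) := rfl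

theorem block_middleTrace {R ι κ : Type*} (X : TraceClass (R × (ι × κ))) (r s : R) :
    block r s (middleTrace X) = partialTrace ι κ (block r s X) := rfl

theorem posSemidef_partialTrace {ι κ : Type*} {X : TraceClass (ι × κ)} (hX : X.1.PosSemidef) :
    (partialTrace ι κ X).1.PosSemidef := by
  have hf := summable_fiber X.2
  refine ⟨?_, fun x => ?_⟩
  · ext k l
    simp only [Matrix.conjTranspose_apply, partialTrace_apply, tsum_star]
    exact tsum_congr fun i => hX.1.apply _ _
  · have e : (x.sum fun k a => x.sum fun l b => star a * (partialTrace ι κ X).1 k l * b)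
        = ∑' i, x.sum fun k a => x.sum fun l b => star a * X.1 (i, k) (i, l) * b := by
      simp only [Finsupp.sum, partialTrace_apply]
      rw [Summable.tsum_finsetSum fun k _ => summable_sum fun l _ =>
        ((hf k l).mul_left _).mul_right _]
      refine Finset.sum_congr rfl fun k _ => ?_
      rw [Summable.tsum_finsetSum fun l _ => ((hf k l).mul_left _).mul_right _]
      refine Finset.sum_congr rfl fun l _ => ?_
      rw [tsum_mul_right, tsum_mul_left]
    rw [e]
    exact tsum_nonneg fun i => (hX.submatrix (Prod.mk i)).2 x

theorem posSemidef_middleTrace {R ι κ : Type*} {X : TraceClass (R × (ι × κ))}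
    (hX : X.1.PosSemidef) : (middleTrace X).1.PosSemidef :=
  posSemidef_partialTrace (hX.submatrix _)

theorem tr_partialTrace {ι κ : Type*} (X : TraceClass (ι × κ)) :
    tr (partialTrace ι κ X) = tr X := by
  have h := (summable_diag X.2).prod_symm.hasSum.prod_fiberwise
    fun k => (summable_fiber X.2 k k).hasSum
  have e : ∑' p : κ × ι, X.1 p.swap p.swap = ∑' p : ι × κ, X.1 p p :=
    (Equiv.prodComm κ ι).tsum_eq fun p : ι × κ => X.1 p p
  rw [e] at h
  exact h.tsum_eq

theorem tr_middleTrace {R ι κ : Type*} (X : TraceClass (R × (ι × κ))) :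
    tr (middleTrace X) = tr X := by
  refine (tr_partialTrace _).trans ?_
  let e : ι × (R × κ) ≃ R × (ι × κ) :=
    ⟨fun p => (p.2.1, (p.1, p.2.2)), fun p => (p.2.1, (p.1, p.2.2)), fun _ => rfl, fun _ => rfl⟩
  exact e.tsum_eq fun p => X.1 p p

open Classical in
theorem amplify_mixingTensor {R A' B' B : Type*} (A : Type*) (M : Channel B' B)
    (X : TraceClass (R × (A' × B'))) :
    amplify (mixingTensor A M) X = idTensor A (amplify M.toOperators (middleTrace X)) := by
  ext ⟨r, a, b⟩ ⟨s, a', b'⟩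
  change (1 : Matrix A A ℂ) a a' * (M.map (partialTrace A' B' (block r s X))).1 b b'
    = if a = a' then (M.map (block r s (middleTrace X))).1 b b' else 0
  rw [block_middleTrace, Matrix.one_apply]
  split_ifs <;> simp

/-! ### The lower bound for semicausal channels -/

theorem neg_logDim_le_condEntropy {A' B' A B : Type*} [Nonempty A] {N : Channel (A' × B') (A × B)}
    (hN : IsSemicausal N) : -logDim A ≤ condEntropy N := by
  classical
  obtain ⟨Nred, hred⟩ := hN
  rw [condEntropy, EReal.neg_le_neg_iff]
  refine (iInf_le _ Nred).trans ?_
  unfold logDim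
  split_ifs with hA
  swap
  · exact le_top
  have := Fintype.ofFinite A
  refine iSup_le fun R => iSup_le fun _ => iSup_le fun ρ => iSup_le fun hρ => ?_
  have hω := N.posSemidef_amplify hρ.1
  have htr := hasSum_diag_amplify N hρ.1
  rw [hρ.2] at htr
  -- Semicausality, applied to each block: the reduced output is the partial trace over `A` of the
  -- full output.
  have hτ : amplify Nred.toOperators (middleTrace ρ) = Matrix.of fun p q =>
      ∑ a, amplify N.toOperators ρ (p.1, (a, p.2)) (q.1, (a, q.2)) := by
    ext p q
    change (Nred.map (block p.1 q.1 (middleTrace ρ))).1 p.2 q.2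
      = ∑ a, (N.map (block p.1 q.1 ρ)).1 (a, p.2) (a, q.2)
    rw [block_middleTrace, ← hred, partialTrace_apply, tsum_fintype]
  have hpsd := Nred.posSemidef_amplify (posSemidef_middleTrace hρ.1)
  rw [amplify_mixingTensor]
  refine relEntropy_le_logb hω htr (posSemidef_idTensor hpsd)
    (exists_hasMatrix_idTensor hpsd (hasSum_diag_amplify Nred (posSemidef_middleTrace hρ.1)).summable)
    (by exact_mod_cast Nat.card_pos) ?_
  rw [hτ, Nat.card_eq_fintype_card]
  exact_mod_cast posSemidef_card_smul_idTensor_sub hω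

/-! ### Relative entropy of a pure state -/

theorem posSemidef_rankOne {ι : Type*} (u : ι → ℂ) :
    (Matrix.of fun i j => u i * star (u j)).PosSemidef := by
  refine ⟨?_, fun x => ?_⟩
  · ext i j
    simp [mul_comm]
  · have e : (x.sum fun i a => x.sum fun j b => star a * (Matrix.of fun i j => u i * star (u j)) i j * b)
        = star (x.sum fun j b => star (u j) * b) * x.sum fun j b => star (u j) * b := by
      simp only [Finsupp.sum, star_sum, Finset.sum_mul_sum]
      refine Finset.sum_congr rfl fun i _ => Finset.sum_congr rfl fun j _ => ?_
      simp only [Matrix.of_apply, star_mul', star_star]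
      ring
    rw [e]
    exact star_mul_self_nonneg _

theorem hasMatrix_rankOne {ι : Type*} (v w : ℓ²(ι, ℂ)) :
    HasMatrix (InnerProductSpace.rankOne ℂ v w) (Matrix.of fun i j => v i * star (w j)) := by
  intro i j
  rw [InnerProductSpace.rankOne_apply, inner_ket_right, lp.coeFn_smul, Pi.smul_apply, smul_eq_mul,
    mul_comm]
  rfl

theorem hasSum_trace_rankOne_mul {ι : Type*} (φ : ℓ²(ι, ℂ)) (T : ℓ²(ι, ℂ) →L[ℂ] ℓ²(ι, ℂ)) :
    HasSum (fun i => InnerProductSpace.rankOne ℂ φ φ (T (ket i)) i) ⟪φ, T φ⟫_ℂ := by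
  rw [← ContinuousLinearMap.adjoint_inner_left]
  have e : (fun i => InnerProductSpace.rankOne ℂ φ φ (T (ket i)) i)
      = fun i => ⟪(ContinuousLinearMap.adjoint T φ) i, φ i⟫_ℂ := by
    ext i
    rw [InnerProductSpace.rankOne_apply, ← ContinuousLinearMap.adjoint_inner_left, inner_ket_right,
      lp.coeFn_smul, Pi.smul_apply, smul_eq_mul, mul_comm]
    rfl
  rw [e]
  exact lp.hasSum_inner _ _

/-- Bound `log (P + ε)` from below by its chord, which acts on `φ` as `log (1 + ε)` because `P φ =
φ`, and `log (σ + ε)` from above by its tangent at `t + ε`. Taking expectations in `φ` leaves at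
least `log (1 + ε) - log (t + ε)`; then `ε → 0`. -/
theorem logb_inv_le_relEntropy {ι : Type*} {φ : ℓ²(ι, ℂ)}
    (hφ : HasSum (fun i => φ i * star (φ i)) 1) {σ : Matrix ι ι ℂ} (hσ : σ.PosSemidef)
    (hex : ∃ T, HasMatrix T σ) {t : ℝ} (ht : 0 < t) (h : (⟪φ, toOp σ φ⟫_ℂ).re ≤ t) :
    (Real.logb 2 t⁻¹ : ℝ) ≤ relEntropy (Matrix.of fun i j => φ i * star (φ j)) σ := by
  classical
  set ρ : Matrix ι ι ℂ := Matrix.of fun i j => φ i * star (φ j) with hρdef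
  set P := InnerProductSpace.rankOne ℂ φ φ with hP
  have hm : HasMatrix P ρ := hasMatrix_rankOne φ φ
  have hρ : ρ.PosSemidef := posSemidef_rankOne φ
  have hφ1 : ⟪φ, φ⟫_ℂ = 1 := by
    refine (lp.hasSum_inner (𝕜 := ℂ) φ φ).unique ?_
    exact hφ
  have hP0 : 0 ≤ P := hm.nonneg hρ
  have hP1 : P ≤ 1 := by
    have hone : HasMatrix (1 : ℓ²(ι, ℂ) →L[ℂ] ℓ²(ι, ℂ)) (1 : Matrix ι ι ℂ) := fun i j => by
      rcases eq_or_ne i j with rfl | h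
      · simp [ket_apply_self]
      · simp [h, ket_apply_ne h]
    refine sub_nonneg.1 ((hone.sub hm).nonneg ?_)
    have h1 := posSemidef_trace_smul_one_sub hρ hφ.summable
    have h2 : ((∑' i, ‖ρ i i‖ : ℝ) : ℂ) = 1 := by
      rw [Complex.ofReal_tsum, ← hφ.tsum_eq]
      exact tsum_congr fun i => (diag_eq_norm hρ i).symm
    rwa [h2, one_smul] at h1
  have hPφ : P φ = φ := by
    rw [hP, InnerProductSpace.rankOne_apply, hφ1, one_smul]
  have hmσ := hasMatrix_toOp hex
  have hσ0 := hmσ.nonneg hσ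
  have hreg : ∀ ε : ℝ, 0 < ε →
      (Real.log (1 + ε) - Real.log (t + ε)) / Real.log 2 ≤ regRelEntropy ρ σ ε := by
    intro ε hε
    have hc : 0 < t + ε := by positivity
    rw [regRelEntropy_eq, hm.toOp_eq]
    gcongr
    rw [(Complex.hasSum_re (hasSum_trace_rankOne_mul φ _)).tsum_eq]
    have hop := sub_nonneg.2 (sub_le_sub (chord_le_log_op hP0 hP1 hε) (log_le_tangent_op hσ0 hc hε))
    have hin := ((ContinuousLinearMap.nonneg_iff_isPositive _).1 hop).inner_nonneg_right φ
    have hK : ∀ a b c d : ℂ, ⟪φ, ((a • 1 + b • P) - (c • 1 + d • (toOp σ + (ε : ℂ) • 1))) φ⟫_ℂ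
        = (a + b) - (c + d * (⟪φ, toOp σ φ⟫_ℂ + ε)) := by
      intro a b c d
      have e : ((a • 1 + b • P) - (c • 1 + d • (toOp σ + (ε : ℂ) • 1))) φ
          = (a • φ + b • P φ) - (c • φ + d • (toOp σ φ + (ε : ℂ) • φ)) := rfl
      rw [e, hPφ]
      simp only [inner_sub_right, inner_add_right, inner_smul_right, hφ1, mul_one]
    rw [sub_apply, inner_sub_right, hK] at hin
    have hre := (Complex.le_def.1 hin).1
    rw [Complex.zero_re, Complex.sub_re] at hre
    refine le_trans ?_ (sub_nonneg.1 hre)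
    rw [← Complex.ofReal_add]
    simp only [Complex.sub_re, Complex.add_re, Complex.re_ofReal_mul, Complex.ofReal_re]
    have h3 : (t + ε)⁻¹ * ((⟪φ, toOp σ φ⟫_ℂ).re + ε) ≤ 1 := by
      rw [inv_mul_le_iff₀ hc]
      linarith
    linarith
  have hlim : Filter.Tendsto (fun ε : ℝ =>
      (((Real.log (1 + ε) - Real.log (t + ε)) / Real.log 2 : ℝ) : EReal)) (𝓝[>] 0)
      (𝓝 ((Real.logb 2 t⁻¹ : ℝ) : EReal)) := by
    refine (continuous_coe_real_ereal.tendsto _).comp ?_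
    have hcont : ContinuousAt (fun ε : ℝ => (Real.log (1 + ε) - Real.log (t + ε)) / Real.log 2) 0 := by
      refine ContinuousAt.div_const (ContinuousAt.sub ?_ ?_) _
      · exact ContinuousAt.log (by fun_prop) (by simp)
      · exact ContinuousAt.log (by fun_prop) (by simpa using ht.ne')
    have h4 := hcont.tendsto.mono_left (nhdsWithin_le_nhds (s := Set.Ioi 0))
    simpa [Real.logb, Real.log_inv] using h4
  rw [← hlim.limsup_eq]
  refine Filter.limsup_le_limsup ?_
  filter_upwards [self_mem_nhdsWithin] with ε hε
  exact EReal.coe_le_coe_iff.2 (hreg ε hε)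

/-! ### Unitary channels -/

/-- Conjugation sends `|v⟩⟨w|` to `|U v⟩⟨U w|`. The scalar `c` lets this apply directly to the
blocks of an entangled pure state. -/
theorem IsUnitaryChannel.exists_map_rankOne {ι κ : Type*} {N : Channel ι κ}
    (hN : IsUnitaryChannel N) : ∃ U : ℓ²(ι, ℂ) ≃ₗᵢ[ℂ] ℓ²(κ, ℂ), ∀ (X : TraceClass ι)
      (v w : ℓ²(ι, ℂ)) (c : ℂ), (X.1 = c • Matrix.of fun i j => v i * star (w j)) →
        (N.map X).1 = c • Matrix.of fun i j => U v i * star (U w j) := by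
  obtain ⟨U, hU⟩ := hN
  refine ⟨U, fun X v w c hX => ?_⟩
  ext i j
  have h1 := hasMatrix_toOp_of_mem (N.map X).2 i j
  have h2 : toOp X.1 = c • InnerProductSpace.rankOne ℂ v w := by
    rw [hX]
    exact ((hasMatrix_rankOne v w).smul c).toOp_eq
  rw [← h1, hU, h2]
  have h3 : (c • InnerProductSpace.rankOne ℂ v w) (U.symm (ket j))
      = c • ⟪w, U.symm (ket j)⟫_ℂ • v := rfl
  rw [h3, map_smul, map_smul, ← U.inner_map_map, U.apply_symm_apply,
    inner_ket_right]
  simp only [lp.coeFn_smul, Pi.smul_apply, smul_eq_mul, Matrix.smul_apply, Matrix.of_apply]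
  ring

theorem logb_le_channelRelEntropy {A' B' A B : Type*} [Nonempty B]
    {N : Channel (A' × B') (A × B)} (hN : IsUnitaryChannel N) (M : Channel B' B) {n : ℕ}
    (hn : 0 < n) {f : Fin n → A} (hf : Function.Injective f) :
    (Real.logb 2 n : ℝ) ≤ channelRelEntropy N.toOperators (mixingTensor A M) := by
  classical
  obtain ⟨U, hU⟩ := hN.exists_map_rankOne
  let b₀ : B := Classical.arbitrary B
  have hn0 : (n : ℝ) ≠ 0 := by positivity
  have hn0' : (n : ℂ) ≠ 0 := by exact_mod_cast hn0
  let s : ℂ := ((√n)⁻¹ : ℝ)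
  have hs : s * star s = (n : ℂ)⁻¹ := by
    simp only [s, Complex.star_def, Complex.conj_ofReal]
    rw [← Complex.ofReal_mul, ← mul_inv, Real.mul_self_sqrt (by positivity)]
    simp
  -- Preimages under `U` of the vectors `|f k⟩|b₀⟩`; the input `∑ s |k⟩ w_k` is thus sent to the
  -- maximally entangled vector `φ` below.
  let w : Fin n → ℓ²(A' × B', ℂ) := fun k => U.symm (ket (f k, b₀))
  let u : Fin n × (A' × B') → ℂ := fun p => s * w p.1 p.2
  have hupsd := posSemidef_rankOne u
  have hfib : ∀ k, HasSum (fun x => u (k, x) * star (u (k, x))) ((n : ℂ)⁻¹) := by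
    intro k
    have h1 : ⟪w k, w k⟫_ℂ = 1 := by
      rw [inner_self_eq_norm_sq_to_K, LinearIsometryEquiv.norm_map, norm_ket]
      simp
    have h2 := (lp.hasSum_inner (𝕜 := ℂ) (w k) (w k)).mul_left ((n : ℂ)⁻¹)
    rw [h1, mul_one] at h2
    have e : (fun x => u (k, x) * star (u (k, x)))
        = fun x => (n : ℂ)⁻¹ * ⟪w k x, w k x⟫_ℂ := by
      ext x
      change s * w k x * star (s * w k x) = (n : ℂ)⁻¹ * (w k x * star (w k x))
      rw [star_mul', ← hs]
      ring
    rw [e]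
    exact h2
  have hutr : HasSum (fun p => u p * star (u p)) 1 := by
    refine hasSum_prod_of_nonneg (fun p => hupsd.diag_nonneg (i := p)) hfib ?_
    convert hasSum_fintype (fun _ : Fin n => (n : ℂ)⁻¹)
    simp [hn0']
  let ρ : TraceClass (Fin n × (A' × B')) :=
    ⟨_, Submodule.subset_span ⟨hupsd, hutr.summable⟩⟩
  have hρ : IsState ρ := ⟨hupsd, hutr.tsum_eq⟩
  let φ : ℓ²(Fin n × (A × B), ℂ) := s • ∑ k, ket (k, (f k, b₀))
  have hφ : ∀ p, φ p = s * ket (f p.1, b₀) p.2 := by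
    rintro ⟨k, x⟩
    simp only [φ, lp.coeFn_smul, Pi.smul_apply, smul_eq_mul, lp.coeFn_sum, Finset.sum_apply]
    congr 1
    rw [Finset.sum_eq_single k]
    · by_cases h : x = (f k, b₀)
      · subst h
        rw [ket_apply_self, ket_apply_self]
      · rw [ket_apply_ne h, ket_apply_ne (by simpa using h)]
    · intro l _ hl
      exact ket_apply_ne fun h => hl (congrArg Prod.fst h).symm
    · simp
  have hω : amplify N.toOperators ρ = Matrix.of fun p q => φ p * star (φ q) := by
    ext p q
    have h := hU (block p.1 q.1 ρ) (w p.1) (w q.1) (s * star s) (by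
      ext x y
      change s * w p.1 x * star (s * w q.1 y) = s * star s * (w p.1 x * star (w q.1 y))
      rw [star_mul']
      ring)
    change (N.map (block p.1 q.1 ρ)).1 p.2 q.2 = φ p * star (φ q)
    rw [h, hφ, hφ, star_mul']
    simp only [w, LinearIsometryEquiv.apply_symm_apply, Matrix.smul_apply, Matrix.of_apply,
      smul_eq_mul]
    ring
  have hωtr := hasSum_diag_amplify N hρ.1
  rw [hρ.2, hω] at hωtr
  set τ := amplify M.toOperators (middleTrace ρ) with hτ
  have hτpsd : τ.PosSemidef := M.posSemidef_amplify (posSemidef_middleTrace hρ.1)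
  have hτtr : HasSum (fun p => τ p p) 1 := by
    have h := hasSum_diag_amplify M (posSemidef_middleTrace hρ.1)
    rwa [tr_middleTrace, hρ.2] at h
  have hex := exists_hasMatrix_idTensor (A := A) hτpsd hτtr.summable
  have hinner : (⟪φ, toOp (idTensor A τ) φ⟫_ℂ).re ≤ (n : ℝ)⁻¹ := by
    have hm := hasMatrix_toOp hex
    have h1 : ⟪φ, toOp (idTensor A τ) φ⟫_ℂ = (n : ℂ)⁻¹ * ∑ k, τ (k, b₀) (k, b₀) := by
      simp only [φ, map_smul, map_sum, inner_smul_left, inner_smul_right, inner_sum, sum_inner,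
        inner_ket_left, hm _ _]
      rw [← Finset.mul_sum, ← mul_assoc, ← hs]
      congr 1
      refine Finset.sum_congr rfl fun k _ => ?_
      -- The factor `1_A` and injectivity of `f` eliminate all cross terms.
      rw [Finset.sum_eq_single k]
      · simp [idTensor]
      · intro l _ hl
        simp [idTensor, hf.ne hl]
      · simp
    have h2 : ∑ k, (τ (k, b₀) (k, b₀)).re ≤ 1 := by
      have h3 := Complex.hasSum_re hτtr
      have h4 := sum_le_hasSum (Finset.univ.image fun k : Fin n => (k, b₀))
        (fun p _ => (Complex.le_def.1 (hτpsd.diag_nonneg (i := p))).1) h3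
      rwa [Finset.sum_image (by simp [Set.InjOn])] at h4
    rw [h1]
    have h5 : ((n : ℂ)⁻¹ * ∑ k, τ (k, b₀) (k, b₀)).re
        = (n : ℝ)⁻¹ * ∑ k, (τ (k, b₀) (k, b₀)).re := by
      rw [← Complex.re_sum, ← Complex.re_ofReal_mul]
      simp
    rw [h5]
    exact mul_le_of_le_one_right (by positivity) h2
  have hfinal := logb_inv_le_relEntropy hωtr (posSemidef_idTensor hτpsd) hex (by positivity) hinner
  rw [inv_inv, ← hω, hτ, ← amplify_mixingTensor] at hfinal
  refine hfinal.trans ?_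
  exact le_iSup_of_le (Fin n) <| le_iSup_of_le inferInstance <| le_iSup_of_le ρ <|
    le_iSup_of_le hρ le_rfl

theorem condEntropy_le_neg_logDim {A' B' A B : Type*} [Nonempty A] [Nonempty B]
    {N : Channel (A' × B') (A × B)} (hN : IsUnitaryChannel N) : condEntropy N ≤ -logDim A := by
  rw [condEntropy, EReal.neg_le_neg_iff]
  refine le_iInf fun M => ?_
  unfold logDim
  split_ifs with hA
  · exact logb_le_channelRelEntropy hN M Nat.card_pos (Finite.equivFin A).symm.injective
  · rw [not_finite_iff_infinite] at hA
    rw [top_le_iff, EReal.eq_top_iff_forall_lt]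
    intro y
    -- For infinite `A`, every `n` is admissible; `n > 2 ^ y` makes `log n` exceed `y`.
    obtain ⟨n, hn⟩ := exists_nat_gt ((2 : ℝ) ^ y)
    have h0 : (0 : ℝ) < n := (Real.rpow_pos_of_pos two_pos y).trans hn
    refine lt_of_lt_of_le ?_ (logb_le_channelRelEntropy hN M (Nat.cast_pos.1 h0)
      ((Infinite.natEmbedding A).injective.comp Fin.val_injective))
    rw [EReal.coe_lt_coe_iff, Real.lt_logb_iff_rpow_lt one_lt_two h0]
    exact hn

end QChannel

end

theorem mainTheorem2 {A' B' A B : Type*} [Countable A'] [Countable B'] [Countable A] [Countable B]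
    [Nonempty A'] [Nonempty B'] [Nonempty A] [Nonempty B] (N : Channel (A' × B') (A × B)) :
    (IsSemicausal N → -logDim A ≤ condEntropy N) ∧
    (IsSemicausal N → IsUnitaryChannel N → condEntropy N = -logDim A) ∧
    (condEntropy N < -logDim A → IsSignaling N) :=
  ⟨neg_logDim_le_condEntropy,
    fun h hU => le_antisymm (condEntropy_le_neg_logDim hU) (neg_logDim_le_condEntropy h),
    fun h hN => absurd h (neg_logDim_le_condEntropy hN).not_gt⟩
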